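/- Let $V=(V,Y,\mathbf 1,\omega)$ be a vertex operator algebra over $\mathbb C$ with weight decomposition $V=\bigoplus_{k\in\mathbb Z}V_k$, write $\mathrm{wt}\,u=k$ for $u\in V_k$, and $Y(\omega,z)=\sum_{k\in\mathbb Z}L(k)z^{-k-2}$. For integers $m,n,p\ge 0$, homogeneous $u\in V$ and $v\in V$ put $$u*_{m,p}^{n}v=\sum_{i=0}^{p}(-1)^i\binom{m+n-p+i}{i}\,\mathrm{Res}_z\frac{(1+z)^{\mathrm{wt}\,u+m}}{z^{m+n-p+i+1}}Y(u,z)v,\qquad u\circ_m^n v=\mathrm{Res}_z\frac{(1+z)^{\mathrm{wt}\,u+m}}{z^{n+m+2}}Y(u,z)v,$$ extended linearly in $u$, where $\binom{x}{i}=x(x-1)\cdots(x-i+1)/i!$ for every integer $x$ and powers of $1+z$ are expanded in nonnegative powers of $z$. Write $\bar*_m^n=*_{m,n}^n$, $*_m^n=*_{m,m}^n$ and $*_n=*_n^n=\bar*_n^n$. Let - $O'_{n,m}(V)$ be the linear span of all $u\circ_m^n v$ and all $L(-1)u+(L(0)+m-n)u$ ($u,v\in V$), and $O_n(V)=O'_{n,n}(V)$;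 - $O''_{n,m}(V)$ be the linear span of all $u*_{m,p_3}^n\big((a*_{p_1,p_2}^{p_3}b)*_{m,p_1}^{p_3}c-a*_{m,p_2}^{p_3}(b*_{m,p_1}^{p_2}c)\big)$ with $a,b,c,u\in V$ and integers $p_1,p_2,p_3\ge 0$; - $O'''_{n,m}(V)$ be the linear span of all $(u*_p^n y)*_{m,p}^n v$ with $p\ge 0$, $u,v\in V$, $y\in O_p(V)$; - $O_{n,m}(V)=O'_{n,m}(V)+O''_{n,m}(V)+O'''_{n,m}(V)$. Let $A_n(V)=V/O_n(V)$ and $A_{n,m}(V)=V/O_{n,m}(V)$ be the quotient vector spaces. Then for all integers $m,n\ge 0$: - for every $k\ge 0$, $*_k$ induces on $A_k(V)$ the structure of an associative $\mathbb C$-algebra with identity $\mathbf 1+O_k(V)$; - $A_{n,m}(V)$ is an $A_n(V)$-$A_m(V)$-bimodule, compatibly with its complex vector space structure, with left action $(u+O_n(V))\cdot(v+O_{n,m}(V))=u\,\bar*_m^n\,v+O_{n,m}(V)$ and right action $(u+O_{n,m}(V))\cdot(v+O_m(V))=u*_m^n v+O_{n,m}(V)$. -/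

import Mathlib

open VertexOperator (ncoeff)

/-- A vertex operator algebra `(V, Y, 𝟏, ω)` over `ℂ`. The state-field map sends `u` to
`Y(u, z) = ∑_{k ∈ ℤ} u_k z^{-k-1}`, a vertex operator in the sense of Mathlib (so that `Y(u, z) v`
is a Laurent series with coefficients in `V`), and `ncoeff (Y u) k` is the mode `u_k`. -/
structure VertexOperatorAlgebra (V : Type*) [AddCommGroup V] [Module ℂ V] where
  /-- The state-field correspondence `u ↦ Y(u, z)`. -/
  Y : V →ₗ[ℂ] VertexOperator ℂ V
  /-- The vacuum vector `𝟏`. -/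
  vac : V
  /-- The conformal (Virasoro) vector `ω`. -/
  conf : V
  /-- The central charge (rank). -/
  charge : ℂ
  /-- The homogeneous subspace `V_k` of weight `k`. -/
  grade : ℤ → Submodule ℂ V
  /-- `V = ⨁_{k ∈ ℤ} V_k`. -/
  isInternal : DirectSum.IsInternal grade
  /-- `dim V_k < ∞`. -/
  finite_grade : ∀ k, FiniteDimensional ℂ (grade k)
  /-- `V_k = 0` for `k` sufficiently small. -/
  grade_bounded : ∃ N : ℤ, ∀ k < N, grade k = ⊥
  /-- `Y(𝟏, z) = id`. -/
  vac_mode : ∀ (k : ℤ) (v : V), ncoeff (Y vac) k v = if k = -1 then v else 0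
  /-- Creation property: `Y(v, z)𝟏` has no pole at `z = 0`. -/
  creation_regular : ∀ (v : V) (k : ℤ), 0 ≤ k → ncoeff (Y v) k vac = 0
  /-- Creation property: the constant term of `Y(v, z)𝟏` is `v`. -/
  creation : ∀ v : V, ncoeff (Y v) (-1) vac = v
  /-- The Jacobi identity, in component form (all three sums have finitely many nonzero terms). -/
  jacobi : ∀ (u v w : V) (r s t : ℤ),
    (∑ᶠ i : ℕ, Ring.choose s i • ncoeff (Y (ncoeff (Y u) (r + i) v)) (s + t - i) w) =
      (∑ᶠ i : ℕ, ((-1) ^ i * Ring.choose r i) •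
        ncoeff (Y u) (s + r - i) (ncoeff (Y v) (t + i) w)) -
      (r.negOnePow : ℤ) •
        ∑ᶠ i : ℕ, ((-1) ^ i * Ring.choose r i) •
          ncoeff (Y v) (t + r - i) (ncoeff (Y u) (s + i) w)
  /-- The Virasoro relations for `L(k) = ω_{k+1}`. -/
  virasoro : ∀ (k l : ℤ) (v : V),
    ncoeff (Y conf) (k + 1) (ncoeff (Y conf) (l + 1) v) -
        ncoeff (Y conf) (l + 1) (ncoeff (Y conf) (k + 1) v) =
      ((k : ℂ) - l) • ncoeff (Y conf) (k + l + 1) v +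
        (if k + l = 0 then (((k : ℂ) ^ 3 - k) / 12 * charge) • v else 0)
  /-- `L(0) = ω_1` acts on `V_k` as the scalar `k`. -/
  L_zero_grade : ∀ (k : ℤ), ∀ v ∈ grade k, ncoeff (Y conf) 1 v = (k : ℂ) • v
  /-- `Y(L(-1)u, z) = d/dz Y(u, z)`, with `L(-1) = ω_0`. -/
  L_neg_one_deriv : ∀ (u v : V) (k : ℤ),
    ncoeff (Y (ncoeff (Y conf) 0 u)) k v = -(k : ℂ) • ncoeff (Y u) (k - 1) v

namespace VertexOperatorAlgebra

variable {V : Type*} [AddCommGroup V] [Module ℂ V] (𝒱 : VertexOperatorAlgebra V)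

/-- The Virasoro operator `L(k) = ω_{k+1}`. -/
noncomputable def L (k : ℤ) : Module.End ℂ V := ncoeff (𝒱.Y 𝒱.conf) (k + 1)

/-- `Res_z (1+z)^a / z^b · Y(u, z) v`, where `(1+z)^a = ∑_{j ≥ 0} (a choose j) z^j`;
only finitely many terms of the sum are nonzero. -/
noncomputable def res (a b : ℤ) (u v : V) : V :=
  ∑ᶠ j : ℕ, Ring.choose a j • ncoeff (𝒱.Y u) (j - b) v

/-- The component of weight `k` of a vector. -/
noncomputable def component (k : ℤ) (u : V) : V :=
  letI := 𝒱.isInternal.chooseDecomposition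
  DirectSum.decompose 𝒱.grade u k

/-- The product `u *_{m,p}^n v`, for `u` of weight `k`:
`∑_{i=0}^p (-1)^i (m+n-p+i choose i) Res_z (1+z)^{k+m} / z^{m+n-p+i+1} Y(u, z) v`. -/
noncomputable def starHom (n m p : ℕ) (k : ℤ) (u v : V) : V :=
  ∑ i ∈ Finset.range (p + 1),
    ((-1) ^ i * Ring.choose ((m : ℤ) + n - p + i) i) •
      𝒱.res (k + m) ((m : ℤ) + n - p + i + 1) u v

/-- The product `u *_{m,p}^n v`, extended linearly from homogeneous `u` to all `u`. -/
noncomputable def star (n m p : ℕ) (u v : V) : V :=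
  ∑ᶠ k : ℤ, 𝒱.starHom n m p k (𝒱.component k u) v

/-- `u *̄_m^n v = u *_{m,n}^n v`. -/
noncomputable def leftStar (n m : ℕ) (u v : V) : V := 𝒱.star n m n u v

/-- `u *_m^n v = u *_{m,m}^n v`. -/
noncomputable def rightStar (n m : ℕ) (u v : V) : V := 𝒱.star n m m u v

/-- `u *_n v`, the common value of `u *_n^n v` and `u *̄_n^n v`. -/
noncomputable def algStar (n : ℕ) (u v : V) : V := 𝒱.star n n n u v

/-- The product `u ∘_m^n v = Res_z (1+z)^{k+m} / z^{n+m+2} Y(u, z) v`, for `u` of weight `k`. -/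
noncomputable def circHom (n m : ℕ) (k : ℤ) (u v : V) : V :=
  𝒱.res (k + m) ((n : ℤ) + m + 2) u v

/-- `O'_{n,m}(V)`, spanned by all `u ∘_m^n v` (`u` homogeneous) and all
`L(-1)u + (L(0) + m - n)u`. -/
noncomputable def O₁ (n m : ℕ) : Submodule ℂ V :=
  Submodule.span ℂ
    ({x | ∃ (k : ℤ) (u v : V), u ∈ 𝒱.grade k ∧ x = 𝒱.circHom n m k u v} ∪
      {x | ∃ u : V, x = 𝒱.L (-1) u + (𝒱.L 0 u + ((m : ℂ) - n) • u)})

/-- `O''_{n,m}(V)`. -/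
noncomputable def O₂ (n m : ℕ) : Submodule ℂ V :=
  Submodule.span ℂ
    {x | ∃ (a b c u : V) (p₁ p₂ p₃ : ℕ), x =
      𝒱.star n m p₃ u
        (𝒱.star p₃ m p₁ (𝒱.star p₃ p₁ p₂ a b) c - 𝒱.star p₃ m p₂ a (𝒱.star p₂ m p₁ b c))}

/-- `O'''_{n,m}(V) = ∑_p (V *_p^n O_p(V)) *_{m,p}^n V`, where `O_p(V) = O'_{p,p}(V)`. -/
noncomputable def O₃ (n m : ℕ) : Submodule ℂ V :=
  Submodule.span ℂ
    {x | ∃ (p : ℕ) (u v : V), ∃ y ∈ 𝒱.O₁ p p, x = 𝒱.star n m p (𝒱.rightStar n p u y) v}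

/-- `O_{n,m}(V) = O'_{n,m}(V) + O''_{n,m}(V) + O'''_{n,m}(V)`. -/
noncomputable def O (n m : ℕ) : Submodule ℂ V := 𝒱.O₁ n m ⊔ 𝒱.O₂ n m ⊔ 𝒱.O₃ n m

/-- The vector space `A_{n,m}(V) = V / O_{n,m}(V)`. -/
abbrev Abi (n m : ℕ) := V ⧸ 𝒱.O n m

/-- The set `A_n(V) = V / O_n(V)`, with `O_n(V) = O'_{n,n}(V)`. It is not reducible, so that it
carries no algebraic structure besides the one that is put on it. -/
noncomputable def Aalg (n : ℕ) := V ⧸ 𝒱.O₁ n n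

/-- The class in `A_n(V)` of a vector of `V`. -/
noncomputable def mkAlg (n : ℕ) (u : V) : 𝒱.Aalg n := (Submodule.Quotient.mk u : V ⧸ 𝒱.O₁ n n)

/-- The class in `A_{n,m}(V)` of a vector of `V`. -/
noncomputable def mkBi (n m : ℕ) (u : V) : 𝒱.Abi n m := Submodule.Quotient.mk u

end VertexOperatorAlgebra

/-! The analytic input is the Jacobi identity multiplied by (1+z₁)^a z₁^{-b} (1+z₂)^{a'} z₂^{-b'}
(`iterateSide_eq`). A residue of Y(u, z) lies in O'_{n,m} once its pole is deep enough compared with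
its power of 1+z (`res_mem_O₁`). Expanding products by the identity and discarding deep poles shows
that O'_{n,m} is stable under both actions (`star_left_mem_O₁`, `star_right_mem_O₁`) and that *_n is
associative modulo O_n (`star_assoc_sub_mem_O₁`). The vacuum is a left identity exactly, and a right
identity modulo O' (`star_vac_left`, `star_vac_right_sub_mem_O₁`).

The bimodule is then formal. The vacuum puts every associator into O''; the pentagon relation makes
O'' stable on both sides, and O''' is stable modulo O''. O''' also makes O_n and O_m act by zero.
Associativity of the mixed products thus needs no residues: it is built into the quotient. -/

/-! ### Binomially weighted sums and Pascal's recursion. -/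

section ChooseSum

open Filter

variable {V W : Type*} [AddCommGroup V] [AddCommGroup W]

/-- The sum `∑_{j ≥ 0} (x choose j) g_j`, for `g` with finitely many nonzero terms. -/
noncomputable def chooseSum (x : ℤ) (g : ℕ → V) : V := ∑ᶠ j : ℕ, Ring.choose x j • g j

theorem finsum_eq_sum_range {f : ℕ → V} {N : ℕ} (h : ∀ j ≥ N, f j = 0) :
    ∑ᶠ j, f j = ∑ j ∈ Finset.range N, f j := by
  refine finsum_eq_sum_of_support_subset _ fun j hj ↦ ?_
  by_contra hN
  exact hj (h j (by simpa using hN))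

theorem chooseSum_eq_sum_range {g : ℕ → V} {N : ℕ} (h : ∀ j ≥ N, g j = 0) (x : ℤ) :
    chooseSum x g = ∑ j ∈ Finset.range N, Ring.choose x j • g j :=
  finsum_eq_sum_range fun j hj ↦ by rw [h j hj, smul_zero]

theorem chooseSum_add {g h : ℕ → V} (hg : ∀ᶠ j in atTop, g j = 0) (hh : ∀ᶠ j in atTop, h j = 0)
    (x : ℤ) : chooseSum x (fun j ↦ g j + h j) = chooseSum x g + chooseSum x h := by
  obtain ⟨N, hN⟩ := eventually_atTop.1 (hg.and hh)
  rw [chooseSum_eq_sum_range (N := N) (fun j hj ↦ by rw [(hN j hj).1, (hN j hj).2, add_zero]),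
    chooseSum_eq_sum_range (fun j hj ↦ (hN j hj).1),
    chooseSum_eq_sum_range (fun j hj ↦ (hN j hj).2), ← Finset.sum_add_distrib]
  simp only [smul_add]

theorem chooseSum_zero_right (x : ℤ) : chooseSum x (fun _ ↦ (0 : V)) = 0 := by
  simp [chooseSum]

theorem chooseSum_zero_left (g : ℕ → V) : chooseSum 0 g = g 0 := by
  rw [chooseSum, finsum_eq_single _ 0]
  · simp
  · intro j hj
    rw [Ring.choose_zero_pos ℤ (Nat.pos_of_ne_zero hj), zero_smul]

theorem chooseSum_succ {g : ℕ → V} (hg : ∀ᶠ j in atTop, g j = 0) (x : ℤ) :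
    chooseSum (x + 1) g = chooseSum x g + chooseSum x fun j ↦ g (j + 1) := by
  obtain ⟨N, hN⟩ := eventually_atTop.1 hg
  rw [chooseSum_eq_sum_range (N := N + 1) (fun j hj ↦ hN j (by omega)),
    chooseSum_eq_sum_range (N := N + 1) (fun j hj ↦ hN j (by omega)),
    chooseSum_eq_sum_range (N := N) (fun j hj ↦ hN (j + 1) (by omega)),
    Finset.sum_range_succ', Finset.sum_range_succ']
  simp only [Ring.choose_succ_succ, add_smul, Finset.sum_add_distrib, Ring.choose_zero_right]
  abel

theorem chooseSum_map {g : ℕ → V} (hg : ∀ᶠ j in atTop, g j = 0) (f : V →+ W) (x : ℤ) :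
    f (chooseSum x g) = chooseSum x fun j ↦ f (g j) := by
  obtain ⟨N, hN⟩ := eventually_atTop.1 hg
  rw [chooseSum_eq_sum_range hN,
    chooseSum_eq_sum_range (N := N) (fun j hj ↦ by rw [hN j hj, map_zero]), map_sum]
  simp only [map_zsmul]

theorem chooseSum_mem {S : AddSubgroup V} {g : ℕ → V} (h : ∀ j, g j ∈ S) (x : ℤ) :
    chooseSum x g ∈ S :=
  finsum_induction (· ∈ S) S.zero_mem (fun _ _ ↦ S.add_mem) fun j ↦ S.zsmul_mem (h j) _

theorem chooseSum_sum {ι : Type*} (s : Finset ι) {g : ι → ℕ → V}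
    (hg : ∀ i ∈ s, ∀ᶠ j in atTop, g i j = 0) (x : ℤ) :
    chooseSum x (fun j ↦ ∑ i ∈ s, g i j) = ∑ i ∈ s, chooseSum x (g i) := by
  classical
  induction s using Finset.induction_on with
  | empty => simp [chooseSum_zero_right]
  | insert i s hi ih =>
    have hs : ∀ᶠ j in atTop, ∑ i ∈ s, g i j = 0 := by
      have := (Filter.eventually_all_finset s).2 fun i h ↦ hg i (Finset.mem_insert_of_mem h)
      filter_upwards [this] with j hj
      exact Finset.sum_eq_zero hj
    simp only [Finset.sum_insert hi]
    rw [chooseSum_add (hg i (Finset.mem_insert_self i s)) hs,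
      ih fun i h ↦ hg i (Finset.mem_insert_of_mem h)]

/-- Serves to truncate an expansion modulo O_n, where all terms with deep poles vanish. -/
theorem chooseSum_sub_sum_mem {S : AddSubgroup V} {g : ℕ → V} (hg : ∀ᶠ j in atTop, g j = 0)
    {M : ℕ} (h : ∀ j ≥ M, g j ∈ S) (x : ℤ) :
    chooseSum x g - ∑ j ∈ Finset.range M, Ring.choose x j • g j ∈ S := by
  obtain ⟨N, hN⟩ := eventually_atTop.1 hg
  rw [chooseSum_eq_sum_range (N := M + N) (fun j hj ↦ hN j (by omega)), Finset.sum_range_add,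
    add_sub_cancel_left]
  exact sum_mem fun j _ ↦ S.zsmul_mem (h _ (by omega)) _

/-- A family of vectors obeying the recursion of `(1 + z)^a z^{-b}` is zero as soon as it vanishes
for `a = 0` and for `b` small. -/
theorem eq_zero_of_pascal {Φ : ℤ → ℤ → V} (h : ∀ a b, Φ (a + 1) b = Φ a b + Φ a (b - 1))
    (h₀ : ∀ b, Φ 0 b = 0) (hb : ∃ B, ∀ a, ∀ b ≤ B, Φ a b = 0) (a b : ℤ) : Φ a b = 0 := by
  obtain ⟨B, hB⟩ := hb
  induction a using Int.induction_on generalizing b with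
  | zero => exact h₀ b
  | succ a ih => rw [h, ih, ih, add_zero]
  -- For negative exponents the recursion is read backwards: Φ(a, b) = -Φ(a, b - 1), climbing from
  -- the bound `B`.
  | pred a ih =>
    have key : ∀ c : ℕ, Φ (-a - 1) (B + c) = 0 := by
      intro c
      induction c with
      | zero => exact hB _ _ (by simp)
      | succ c ihc =>
        have := h (-a - 1) (B + (c + 1 : ℕ))
        rw [sub_add_cancel, ih, show B + ((c + 1 : ℕ) : ℤ) - 1 = B + c by push_cast; ring, ihc,
          add_zero] at this
        exact this.symm
    rcases le_total b B with hbB | hbB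
    · exact hB _ _ hbB
    · obtain ⟨c, rfl⟩ := Int.exists_add_of_le hbB
      exact key c

end ChooseSum

/-! ### Residues of vertex operators. -/

namespace VertexOperatorAlgebra

open Filter

variable {V : Type*} [AddCommGroup V] [Module ℂ V] (𝒱 : VertexOperatorAlgebra V)

theorem exists_mode_eq_zero (u v : V) : ∃ N : ℤ, ∀ k ≥ N, ncoeff (𝒱.Y u) k v = 0 := by
  refine ⟨-(HahnSeries.order ((HahnModule.of ℂ).symm (𝒱.Y u v))), fun k hk ↦ ?_⟩
  exact VertexOperator.ncoeff_eq_zero_of_lt_order _ _ _ (by omega)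

theorem eventually_mode_eq_zero (u v : V) (c : ℤ) :
    ∀ᶠ j : ℕ in atTop, ncoeff (𝒱.Y u) (j + c) v = 0 := by
  obtain ⟨N, hN⟩ := 𝒱.exists_mode_eq_zero u v
  filter_upwards [eventually_ge_atTop (N - c).toNat] with j hj
  exact hN _ (by omega)

theorem res_eq_chooseSum (a b : ℤ) (u v : V) :
    𝒱.res a b u v = chooseSum a fun j ↦ ncoeff (𝒱.Y u) (j - b) v := rfl

theorem eventually_mode_sub_eq_zero (u v : V) (c : ℤ) :
    ∀ᶠ j : ℕ in atTop, ncoeff (𝒱.Y u) (j - c) v = 0 :=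
  𝒱.eventually_mode_eq_zero u v (-c)

/-- `Res_z (1+z)^a / z^b Y(u, z) v` as a bilinear map. -/
noncomputable def resL (a b : ℤ) : V →ₗ[ℂ] V →ₗ[ℂ] V :=
  LinearMap.mk₂ ℂ (𝒱.res a b)
    (fun u u' v ↦ by
      simp only [res_eq_chooseSum, map_add, Pi.add_apply, LinearMap.add_apply]
      exact chooseSum_add (𝒱.eventually_mode_sub_eq_zero _ _ _)
        (𝒱.eventually_mode_sub_eq_zero _ _ _) _)
    (fun c u v ↦ by
      simp only [res_eq_chooseSum, map_smul, Pi.smul_apply, LinearMap.smul_apply]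
      exact (chooseSum_map (𝒱.eventually_mode_sub_eq_zero _ _ _)
        (DistribSMul.toAddMonoidHom V c) _).symm)
    (fun u v v' ↦ by
      simp only [res_eq_chooseSum, map_add]
      exact chooseSum_add (𝒱.eventually_mode_sub_eq_zero _ _ _)
        (𝒱.eventually_mode_sub_eq_zero _ _ _) _)
    (fun c u v ↦ by
      simp only [res_eq_chooseSum, map_smul]
      exact (chooseSum_map (𝒱.eventually_mode_sub_eq_zero _ _ _)
        (DistribSMul.toAddMonoidHom V c) _).symm)

@[simp] theorem resL_apply (a b : ℤ) (u v : V) : 𝒱.resL a b u v = 𝒱.res a b u v := rfl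

@[simp] theorem res_zero_left (a b : ℤ) (v : V) : 𝒱.res a b 0 v = 0 := by
  rw [← resL_apply, map_zero, LinearMap.zero_apply]

@[simp] theorem res_zero_right (a b : ℤ) (u : V) : 𝒱.res a b u 0 = 0 := by
  rw [← resL_apply, map_zero]

theorem res_zero_exponent (b : ℤ) (u v : V) : 𝒱.res 0 b u v = ncoeff (𝒱.Y u) (-b) v := by
  rw [res_eq_chooseSum, chooseSum_zero_left]
  simp

theorem res_succ (a b : ℤ) (u v : V) :
    𝒱.res (a + 1) b u v = 𝒱.res a b u v + 𝒱.res a (b - 1) u v := by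
  simp only [res_eq_chooseSum]
  rw [chooseSum_succ (𝒱.eventually_mode_sub_eq_zero _ _ _)]
  congr 2 with j
  rw [show ((j + 1 : ℕ) : ℤ) - b = j - (b - 1) by push_cast; ring]

/-- The bound is uniform in `a` because (1+z)^a has only nonnegative powers of z;
`eq_zero_of_pascal` needs this uniformity. -/
theorem exists_res_eq_zero (u v : V) : ∃ B, ∀ a, ∀ b ≤ B, 𝒱.res a b u v = 0 := by
  obtain ⟨N, hN⟩ := 𝒱.exists_mode_eq_zero u v
  refine ⟨-N, fun a b hb ↦ ?_⟩
  rw [res_eq_chooseSum, chooseSum_eq_sum_range (N := 0) (fun j _ ↦ hN _ (by omega))]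
  simp

theorem eventually_res_eq_zero (u v : V) (c : ℤ) :
    ∀ᶠ j : ℕ in atTop, ∀ a, 𝒱.res a (c - j) u v = 0 := by
  obtain ⟨B, hB⟩ := 𝒱.exists_res_eq_zero u v
  filter_upwards [eventually_ge_atTop (c - B).toNat] with j hj a
  exact hB a _ (by omega)

/-! ### The Jacobi identity with general factors. -/

section Jacobi

variable (u v w : V) (r : ℤ)

/-- The iterate side of the Jacobi identity for `(1+z₁)^a z₁^{-b} (1+z₂)^{a'} z₂^{-b'} (z₁-z₂)^r`. -/
noncomputable def iterateSide (a b a' b' : ℤ) : V :=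
  -- Substituting z₁ = z₂ + z₀, the index `j` expands (1+z₁)^a in powers of z₀/(1+z₂), and `q`
  -- expands z₁^{-b} in powers of z₀/z₂.
  chooseSum a fun j ↦ chooseSum (-b) fun q ↦
    𝒱.res (a + a' - j) (b + b' + q) (ncoeff (𝒱.Y u) (r + j + q) v) w

/-- A product side of the Jacobi identity for
`(1+z₁)^a z₁^{-b} (1+z₂)^{a'} z₂^{-b'} (z₁-z₂)^r`, expanded for `|z₁| > |z₂|`. -/
noncomputable def productSide (a b a' b' : ℤ) : V :=
  chooseSum r fun i ↦ (-1 : ℤ) ^ i • 𝒱.res a (b - r + i) u (𝒱.res a' (b' - i) v w)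

theorem eventually_iterate_eq_zero :
    ∀ᶠ j : ℕ in atTop, ∀ q : ℕ, ncoeff (𝒱.Y u) (r + j + q) v = 0 := by
  obtain ⟨N, hN⟩ := 𝒱.exists_mode_eq_zero u v
  filter_upwards [eventually_ge_atTop (N - r).toNat] with j hj q
  exact hN _ (by omega)

theorem eventually_iterate_eq_zero' (j : ℕ) :
    ∀ᶠ q : ℕ in atTop, ncoeff (𝒱.Y u) (r + j + q) v = 0 := by
  filter_upwards [𝒱.eventually_iterate_eq_zero u v r] with q hq
  rw [add_right_comm]
  exact hq j

theorem iterateSide_succ_right (a b a' b' : ℤ) :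
    𝒱.iterateSide u v w r a b (a' + 1) b' =
      𝒱.iterateSide u v w r a b a' b' + 𝒱.iterateSide u v w r a b a' (b' - 1) := by
  simp only [iterateSide]
  rw [← chooseSum_add]
  · congr 1 with j
    rw [← chooseSum_add]
    · congr 1 with q
      rw [show a + (a' + 1) - j = a + a' - j + 1 by ring, res_succ]
      congr 2
      ring
    all_goals
      filter_upwards [𝒱.eventually_iterate_eq_zero' u v r j] with q hq
      simp [hq]
  all_goals
    filter_upwards [𝒱.eventually_iterate_eq_zero u v r] with j hj
    simp [hj, chooseSum_zero_right]

/-- With z₁ = z₂ + z₀, the extra factor is 1 + z₁ = (1 + z₂) + z₀. The z₀ term arises on the left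
from Pascal's rule in `a`, on the right from Pascal's rule in `-b`. -/
theorem iterateSide_succ_left (a b a' b' : ℤ) :
    𝒱.iterateSide u v w r (a + 1) b a' b' =
      𝒱.iterateSide u v w r a b a' b' + 𝒱.iterateSide u v w r a (b - 1) a' b' := by
  simp only [iterateSide]
  rw [chooseSum_succ, ← chooseSum_add, ← chooseSum_add]
  · congr 1 with j
    rw [show -(b - 1) = -b + 1 by ring, chooseSum_succ, ← add_assoc]
    · congr 1
      · rw [← chooseSum_add]
        · congr 1 with q
          rw [show a + 1 + a' - j = a + a' - j + 1 by ring, res_succ]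
          congr 2
          ring
        all_goals
          filter_upwards [𝒱.eventually_iterate_eq_zero' u v r j] with q hq
          simp [hq]
      · congr 1 with q
        push_cast
        rw [show a + 1 + a' - ((j : ℤ) + 1) = a + a' - j by ring,
          show b - 1 + b' + ((q : ℤ) + 1) = b + b' + q by ring,
          show r + ((j : ℤ) + 1) + q = r + j + (q + 1) by ring]
    · filter_upwards [𝒱.eventually_iterate_eq_zero' u v r j] with q hq
      simp [hq]
  all_goals
    first
    | filter_upwards [𝒱.eventually_iterate_eq_zero u v r] with j hj
      simp [hj, chooseSum_zero_right]
      done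
    | filter_upwards [(tendsto_add_atTop_nat 1).eventually
        (𝒱.eventually_iterate_eq_zero u v r)] with j hj
      push_cast at hj ⊢
      simp [hj, chooseSum_zero_right]

theorem exists_iterateSide_eq_zero :
    ∃ B, ∀ a b a' b', b + b' ≤ B → 𝒱.iterateSide u v w r a b a' b' = 0 := by
  obtain ⟨N, hN⟩ := eventually_atTop.1 (𝒱.eventually_iterate_eq_zero u v r)
  have : ∃ B, ∀ j < N, ∀ q < N, ∀ a, ∀ b ≤ B,
      𝒱.res a b (ncoeff (𝒱.Y u) (r + j + q) v) w = 0 := by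
    choose B hB using fun j q : ℕ ↦ 𝒱.exists_res_eq_zero (ncoeff (𝒱.Y u) (r + j + q) v) w
    obtain ⟨M, hM⟩ := ((Finset.range N ×ˢ Finset.range N).image fun p ↦ B p.1 p.2).bddBelow
    refine ⟨M, fun j hj q hq a b hb ↦ hB j q a b (hb.trans (hM ?_))⟩
    simp only [Finset.coe_image, Set.mem_image, Finset.mem_coe, Finset.mem_product,
      Finset.mem_range]
    exact ⟨(j, q), ⟨hj, hq⟩, rfl⟩
  obtain ⟨B, hB⟩ := this
  refine ⟨B - N, fun a b a' b' hb ↦ ?_⟩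
  rw [iterateSide]
  convert chooseSum_zero_right a with j
  convert chooseSum_zero_right (-b) with q
  by_cases hj : N ≤ j
  · rw [hN j hj, res_zero_left]
  by_cases hq : N ≤ q
  · rw [add_right_comm r, hN q hq, res_zero_left]
  exact hB j (by omega) q (by omega) _ _ (by omega)

theorem eventually_productSide_eq_zero (b' : ℤ) :
    ∀ᶠ i : ℕ in atTop, ∀ a b a',
      (-1 : ℤ) ^ i • 𝒱.res a (b - r + i) u (𝒱.res a' (b' - i) v w) = 0 := by
  filter_upwards [𝒱.eventually_res_eq_zero v w b'] with i hi a b a'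
  rw [hi, res_zero_right, smul_zero]

theorem productSide_succ_left (a b a' b' : ℤ) :
    𝒱.productSide u v w r (a + 1) b a' b' =
      𝒱.productSide u v w r a b a' b' + 𝒱.productSide u v w r a (b - 1) a' b' := by
  simp only [productSide]
  rw [← chooseSum_add]
  · congr 1 with i
    rw [res_succ, smul_add]
    congr 3
    ring
  all_goals
    filter_upwards [𝒱.eventually_productSide_eq_zero u v w r b'] with i hi
    exact hi _ _ _

theorem productSide_succ_right (a b a' b' : ℤ) :
    𝒱.productSide u v w r a b (a' + 1) b' =
      𝒱.productSide u v w r a b a' b' + 𝒱.productSide u v w r a b a' (b' - 1) := by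
  simp only [productSide]
  rw [← chooseSum_add]
  · congr 1 with i
    rw [res_succ, ← resL_apply, map_add, smul_add]
    simp only [resL_apply]
    congr 4
    ring
  · filter_upwards [𝒱.eventually_productSide_eq_zero u v w r b'] with i hi
    exact hi _ _ _
  · filter_upwards [𝒱.eventually_productSide_eq_zero u v w r (b' - 1)] with i hi
    exact hi _ _ _

theorem exists_productSide_eq_zero_right :
    ∃ B, ∀ a b a', ∀ b' ≤ B, 𝒱.productSide u v w r a b a' b' = 0 := by
  obtain ⟨B, hB⟩ := 𝒱.exists_res_eq_zero v w
  refine ⟨B, fun a b a' b' hb ↦ ?_⟩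
  rw [productSide]
  convert chooseSum_zero_right r with i
  rw [hB _ _ (by omega), res_zero_right, smul_zero]

/-- Here the bound depends on the inner residue, so the recursion in (a, b) has to be run with (a',
b') fixed, and conversely. -/
theorem exists_productSide_eq_zero_left (a' b' : ℤ) :
    ∃ B, ∀ a, ∀ b ≤ B, 𝒱.productSide u v w r a b a' b' = 0 := by
  obtain ⟨N, hN⟩ := eventually_atTop.1 (𝒱.eventually_res_eq_zero v w b')
  choose B hB using fun i : ℕ ↦ 𝒱.exists_res_eq_zero u (𝒱.res a' (b' - i) v w)
  obtain ⟨M, hM⟩ := ((Finset.range N).image B).bddBelow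
  refine ⟨M + r - N, fun a b hb ↦ ?_⟩
  rw [productSide]
  convert chooseSum_zero_right r with i
  by_cases hi : N ≤ i
  · rw [hN i hi, res_zero_right, smul_zero]
  · have : M ≤ B i := hM (by simpa using ⟨i, by omega, rfl⟩)
    rw [hB i _ _ (by omega), smul_zero]

theorem iterateSide_base (b b' : ℤ) :
    𝒱.iterateSide u v w r 0 b 0 b' = 𝒱.productSide u v w r 0 b 0 b' -
      (r.negOnePow : ℤ) • 𝒱.productSide v u w r 0 b' 0 b := by
  have := 𝒱.jacobi u v w r (-b) (-b')
  simp only [iterateSide, productSide, chooseSum_zero_left, res_zero_exponent]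
  simp only [chooseSum]
  convert this using 4 with i i i
  · simp only [CharP.cast_eq_zero, add_zero, sub_zero, res_zero_exponent]
    rw [show -(b + b' + (i : ℤ)) = -b + -b' - i by ring]
  · rw [mul_comm, mul_smul, show -(b - r + (i : ℤ)) = -b + r - i by ring,
      show -(b' - (i : ℤ)) = -b' + i by ring]
  · ext i
    rw [mul_comm, mul_smul, show -(b' - r + (i : ℤ)) = -b' + r - i by ring,
      show -(b - (i : ℤ)) = -b + i by ring]

/-- The Jacobi identity, multiplied by `(1+z₁)^a z₁^{-b} (1+z₂)^{a'} z₂^{-b'}`. -/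
theorem iterateSide_eq (a b a' b' : ℤ) :
    𝒱.iterateSide u v w r a b a' b' = 𝒱.productSide u v w r a b a' b' -
      (r.negOnePow : ℤ) • 𝒱.productSide v u w r a' b' a b := by
  rw [← sub_eq_zero]
  refine eq_zero_of_pascal (Φ := fun a b ↦ 𝒱.iterateSide u v w r a b a' b' -
    (𝒱.productSide u v w r a b a' b' - (r.negOnePow : ℤ) • 𝒱.productSide v u w r a' b' a b))
    (fun a b ↦ ?_) (fun b ↦ ?_) ?_ a b
  · simp only [iterateSide_succ_left, productSide_succ_left, productSide_succ_right, smul_add]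
    abel
  · refine eq_zero_of_pascal (Φ := fun a' b' ↦ 𝒱.iterateSide u v w r 0 b a' b' -
      (𝒱.productSide u v w r 0 b a' b' - (r.negOnePow : ℤ) • 𝒱.productSide v u w r a' b' 0 b))
      (fun a' b' ↦ ?_) (fun b' ↦ ?_) ?_ a' b'
    · simp only [iterateSide_succ_right, productSide_succ_left, productSide_succ_right, smul_add]
      abel
    · rw [iterateSide_base, sub_self]
    · obtain ⟨B₁, h₁⟩ := 𝒱.exists_iterateSide_eq_zero u v w r
      obtain ⟨B₂, h₂⟩ := 𝒱.exists_productSide_eq_zero_right u v w r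
      obtain ⟨B₃, h₃⟩ := 𝒱.exists_productSide_eq_zero_left v u w r 0 b
      refine ⟨min (B₁ - b) (min B₂ B₃), fun a' b' hb ↦ ?_⟩
      rw [h₁ _ _ _ _ (by omega), h₂ _ _ _ _ (by omega), h₃ _ _ (by omega)]
      simp
  · obtain ⟨B₁, h₁⟩ := 𝒱.exists_iterateSide_eq_zero u v w r
    obtain ⟨B₂, h₂⟩ := 𝒱.exists_productSide_eq_zero_left u v w r a' b'
    obtain ⟨B₃, h₃⟩ := 𝒱.exists_productSide_eq_zero_right v u w r
    refine ⟨min (B₁ - b') (min B₂ B₃), fun a b hb ↦ ?_⟩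
    rw [h₁ _ _ _ _ (by omega), h₂ _ _ (by omega), h₃ _ _ _ _ (by omega)]
    simp

end Jacobi

/-! ### Homogeneous components and L(0)-eigenvectors. -/

section Grading

theorem component_of_mem {k : ℤ} {u : V} (hu : u ∈ 𝒱.grade k) : 𝒱.component k u = u :=
  let _ := 𝒱.isInternal.chooseDecomposition
  DirectSum.decompose_of_mem_same 𝒱.grade hu

theorem component_of_mem_ne {k l : ℤ} {u : V} (hu : u ∈ 𝒱.grade k) (h : k ≠ l) :
    𝒱.component l u = 0 :=
  let _ := 𝒱.isInternal.chooseDecomposition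
  DirectSum.decompose_of_mem_ne 𝒱.grade hu h

theorem component_mem (k : ℤ) (u : V) : 𝒱.component k u ∈ 𝒱.grade k := by
  unfold component
  exact SetLike.coe_mem _

theorem component_add (k : ℤ) (u v : V) :
    𝒱.component k (u + v) = 𝒱.component k u + 𝒱.component k v := by
  simp [component, DirectSum.decompose_add]

theorem component_smul (k : ℤ) (c : ℂ) (u : V) :
    𝒱.component k (c • u) = c • 𝒱.component k u := by
  let _ := 𝒱.isInternal.chooseDecomposition
  exact congrArg Subtype.val
    (DFunLike.congr_fun (DirectSum.decompose_smul 𝒱.grade c u) k)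

theorem exists_eq_sum_component (u : V) :
    ∃ s : Finset ℤ, (∀ k ∉ s, 𝒱.component k u = 0) ∧ ∑ k ∈ s, 𝒱.component k u = u := by
  classical
  let _ := 𝒱.isInternal.chooseDecomposition
  refine ⟨(DirectSum.decompose 𝒱.grade u).support, fun k hk ↦ ?_,
    DirectSum.sum_support_decompose 𝒱.grade u⟩
  rw [component, DFinsupp.notMem_support_iff.1 hk, ZeroMemClass.coe_zero]

theorem finite_support_component (u : V) : {k | 𝒱.component k u ≠ 0}.Finite := by
  obtain ⟨s, hs, -⟩ := 𝒱.exists_eq_sum_component u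
  exact s.finite_toSet.subset fun k hk ↦ by_contra fun h ↦ hk (hs k h)

/-- A property that is stable under addition holds for all vectors if it does for homogeneous
ones. -/
theorem homogeneous_induction {P : V → Prop} (hom : ∀ k, ∀ u ∈ 𝒱.grade k, P u)
    (add : ∀ u v, P u → P v → P (u + v)) (u : V) : P u := by
  obtain ⟨s, -, hs⟩ := 𝒱.exists_eq_sum_component u
  rw [← hs]
  exact Finset.sum_induction _ P add (hom 0 0 (zero_mem _)) fun k _ ↦ hom k _ (𝒱.component_mem k u)

/-- L(0) acts on distinct weight spaces by distinct scalars, so all components but one vanish.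
Weights of modes are computed this way. -/
theorem mem_grade_of_L_zero {k : ℤ} {u : V} (h : ncoeff (𝒱.Y 𝒱.conf) 1 u = (k : ℂ) • u) :
    u ∈ 𝒱.grade k := by
  have key (j : ℤ) (v : V) :
      𝒱.component j (ncoeff (𝒱.Y 𝒱.conf) 1 v) = (j : ℂ) • 𝒱.component j v := by
    induction v using 𝒱.homogeneous_induction with
    | hom l v hv =>
      rw [𝒱.L_zero_grade l v hv, component_smul]
      rcases eq_or_ne l j with rfl | hlj
      · rfl
      · rw [𝒱.component_of_mem_ne hv hlj, smul_zero, smul_zero]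
    | add v w hv hw => rw [map_add, component_add, component_add, hv, hw, smul_add]
  obtain ⟨s, -, hs⟩ := 𝒱.exists_eq_sum_component u
  rw [← hs]
  refine sum_mem fun j _ ↦ ?_
  rcases eq_or_ne j k with rfl | hjk
  · exact 𝒱.component_mem j u
  · have hj := key j u
    rw [h, component_smul, ← sub_eq_zero, ← sub_smul] at hj
    rcases smul_eq_zero.1 hj with h0 | h0
    · exact absurd (by exact_mod_cast (sub_eq_zero.1 h0).symm) hjk
    · rw [h0]
      exact zero_mem _

end Grading

/-! ### Commutators of L(-1) and L(0) with modes and residues. -/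

section Virasoro

theorem L_neg_one_apply (v : V) : 𝒱.L (-1) v = ncoeff (𝒱.Y 𝒱.conf) 0 v := rfl

theorem L_zero_apply (v : V) : 𝒱.L 0 v = ncoeff (𝒱.Y 𝒱.conf) 1 v := rfl

theorem mode_commutator (u v w : V) (s t : ℤ) :
    chooseSum s (fun i ↦ ncoeff (𝒱.Y (ncoeff (𝒱.Y u) i v)) (s + t - i) w) =
      ncoeff (𝒱.Y u) s (ncoeff (𝒱.Y v) t w) - ncoeff (𝒱.Y v) t (ncoeff (𝒱.Y u) s w) := by
  have h := 𝒱.iterateSide_eq u v w 0 0 (-s) 0 (-t)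
  simp only [iterateSide, productSide, chooseSum_zero_left, res_zero_exponent, Int.negOnePow_zero,
    zero_add, neg_neg, pow_zero, one_smul, Nat.cast_zero, sub_zero, add_zero, Units.val_one] at h
  rw [← h]
  congr 1 with i
  rw [show s + t - i = -(-s + -t + i) by ring]

theorem L_neg_one_mode (u v : V) (t : ℤ) :
    𝒱.L (-1) (ncoeff (𝒱.Y u) t v) =
      ncoeff (𝒱.Y u) t (𝒱.L (-1) v) + ncoeff (𝒱.Y (𝒱.L (-1) u)) t v := by
  have h := 𝒱.mode_commutator 𝒱.conf u v 0 t
  simp only [chooseSum_zero_left, Nat.cast_zero, sub_zero, zero_add] at h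
  rw [L_neg_one_apply, L_neg_one_apply, L_neg_one_apply, h]
  abel

theorem L_zero_mode {k : ℤ} {u : V} (hu : u ∈ 𝒱.grade k) (v : V) (t : ℤ) :
    𝒱.L 0 (ncoeff (𝒱.Y u) t v) = ncoeff (𝒱.Y u) t (𝒱.L 0 v) +
      ncoeff (𝒱.Y (𝒱.L (-1) u)) (t + 1) v + (k : ℂ) • ncoeff (𝒱.Y u) t v := by
  -- Writing 1 as `0 + 1` lets `chooseSum_succ` reduce the commutator with ω_1 to its two terms.
  have h := 𝒱.mode_commutator 𝒱.conf u v (0 + 1) t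
  rw [chooseSum_succ, chooseSum_zero_left, chooseSum_zero_left] at h
  · simp only [Nat.cast_zero, sub_zero, zero_add, Nat.cast_one, 𝒱.L_zero_grade k u hu, map_smul,
      Pi.smul_apply, LinearMap.smul_apply, add_sub_cancel_left] at h
    rw [L_neg_one_apply, L_zero_apply, L_zero_apply, add_comm t, add_assoc, h]
    abel
  · filter_upwards [𝒱.eventually_mode_eq_zero 𝒱.conf u 0] with i hi
    rw [add_zero] at hi
    simp [hi]

theorem mode_mem_grade {k l : ℤ} {u v : V} (hu : u ∈ 𝒱.grade k) (hv : v ∈ 𝒱.grade l) (t : ℤ) :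
    ncoeff (𝒱.Y u) t v ∈ 𝒱.grade (k + l - t - 1) := by
  apply 𝒱.mem_grade_of_L_zero
  have h := 𝒱.L_zero_mode hu v t
  rw [L_zero_apply, L_zero_apply, 𝒱.L_zero_grade l v hv, L_neg_one_apply, 𝒱.L_neg_one_deriv,
    add_sub_cancel_right] at h
  rw [h, map_smul]
  push_cast
  module

theorem L_neg_one_mem_grade {k : ℤ} {u : V} (hu : u ∈ 𝒱.grade k) :
    𝒱.L (-1) u ∈ 𝒱.grade (k + 1) := by
  apply 𝒱.mem_grade_of_L_zero
  have h := 𝒱.virasoro 0 (-1) u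
  simp only [zero_add, neg_add_cancel, 𝒱.L_zero_grade k u hu, map_smul] at h
  rw [L_neg_one_apply, sub_eq_iff_eq_add.1 h]
  push_cast
  norm_num
  module

theorem vac_mem_grade : 𝒱.vac ∈ 𝒱.grade 0 := by
  apply 𝒱.mem_grade_of_L_zero
  rw [𝒱.creation_regular _ _ (by norm_num)]
  simp

/-- Integration by parts: L(-1) differentiates Y(u, z), and the residue of a derivative is zero. -/
theorem res_L_neg_one (a b : ℤ) (u v : V) :
    𝒱.res a b (𝒱.L (-1) u) v = (b : ℂ) • 𝒱.res a (b + 1) u v - (a : ℂ) • 𝒱.res (a - 1) b u v := by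
  rw [← sub_eq_zero]
  refine eq_zero_of_pascal (Φ := fun a b ↦ 𝒱.res a b (𝒱.L (-1) u) v -
    ((b : ℂ) • 𝒱.res a (b + 1) u v - (a : ℂ) • 𝒱.res (a - 1) b u v))
    (fun a b ↦ ?_) (fun b ↦ ?_) ?_ a b
  · have h := 𝒱.res_succ (a - 1) b u v
    rw [sub_add_cancel] at h
    rw [res_succ, 𝒱.res_succ a (b + 1)]
    simp only [add_sub_cancel_right, sub_add_cancel]
    rw [h]
    push_cast
    module
  · rw [res_zero_exponent, res_zero_exponent, L_neg_one_apply, 𝒱.L_neg_one_deriv,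
      show -(b + 1) = -b - 1 by ring]
    push_cast
    module
  · obtain ⟨B, hB⟩ := 𝒱.exists_res_eq_zero (𝒱.L (-1) u) v
    obtain ⟨C, hC⟩ := 𝒱.exists_res_eq_zero u v
    refine ⟨min B (C - 1), fun a b hb ↦ ?_⟩
    rw [hB _ _ (by omega), hC _ _ (by omega), hC _ _ (by omega)]
    simp

/-- The exponent `a + 1` fits the weight of L(-1)u, which is one more than that of u. -/
theorem res_succ_L_neg_one (a b : ℤ) (u v : V) :
    𝒱.res (a + 1) b (𝒱.L (-1) u) v =
      (b : ℂ) • 𝒱.res a (b + 1) u v + ((b : ℂ) - a - 1) • 𝒱.res a b u v := by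
  rw [res_L_neg_one, res_succ, add_sub_cancel_right, add_sub_cancel_right]
  push_cast
  module

theorem L_neg_one_res (a b : ℤ) (u v : V) :
    𝒱.L (-1) (𝒱.res a b u v) = 𝒱.res a b u (𝒱.L (-1) v) + 𝒱.res a b (𝒱.L (-1) u) v := by
  simp only [res_eq_chooseSum]
  rw [← chooseSum_add (𝒱.eventually_mode_sub_eq_zero _ _ _) (𝒱.eventually_mode_sub_eq_zero _ _ _)]
  refine (chooseSum_map (𝒱.eventually_mode_sub_eq_zero _ _ _)
    (𝒱.L (-1)).toAddMonoidHom _).trans ?_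
  congr 1 with j
  exact 𝒱.L_neg_one_mode u v _

theorem L_zero_res {k : ℤ} {u : V} (hu : u ∈ 𝒱.grade k) (a b : ℤ) (v : V) :
    𝒱.L 0 (𝒱.res a b u v) = 𝒱.res a b u (𝒱.L 0 v) + 𝒱.res a (b - 1) (𝒱.L (-1) u) v +
      (k : ℂ) • 𝒱.res a b u v := by
  have h : (k : ℂ) • 𝒱.res a b u v = 𝒱.res a b ((k : ℂ) • u) v := by
    rw [← resL_apply, ← resL_apply, map_smul, LinearMap.smul_apply]
  rw [h]
  simp only [res_eq_chooseSum]
  rw [← chooseSum_add (𝒱.eventually_mode_sub_eq_zero _ _ _) (𝒱.eventually_mode_sub_eq_zero _ _ _),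
    ← chooseSum_add _ (𝒱.eventually_mode_sub_eq_zero _ _ _)]
  · refine (chooseSum_map (𝒱.eventually_mode_sub_eq_zero _ _ _)
      (𝒱.L 0).toAddMonoidHom _).trans ?_
    congr 1 with j
    rw [map_smul, map_smul, Pi.smul_apply, LinearMap.smul_apply, ← sub_add]
    exact 𝒱.L_zero_mode hu v _
  · filter_upwards [𝒱.eventually_mode_sub_eq_zero u (𝒱.L 0 v) b,
      𝒱.eventually_mode_sub_eq_zero (𝒱.L (-1) u) v (b - 1)] with j h₁ h₂
    rw [h₁, h₂, add_zero]

/-- The commutator of `L(-1) + L(0)` with a residue of `Y(u, z)`. -/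
theorem L_neg_one_add_L_zero_res {k : ℤ} {u : V} (hu : u ∈ 𝒱.grade k) (a b : ℤ) (v : V) :
    𝒱.L (-1) (𝒱.res a b u v) + 𝒱.L 0 (𝒱.res a b u v) =
      𝒱.res a b u (𝒱.L (-1) v + 𝒱.L 0 v) + (b : ℂ) • 𝒱.res a (b + 1) u v +
        ((b : ℂ) + k - a - 1) • 𝒱.res a b u v := by
  have h₁ := 𝒱.res_succ a b (𝒱.L (-1) u) v
  rw [res_succ_L_neg_one] at h₁
  have h₂ : 𝒱.res a b u (𝒱.L (-1) v + 𝒱.L 0 v) =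
      𝒱.res a b u (𝒱.L (-1) v) + 𝒱.res a b u (𝒱.L 0 v) := by
    rw [← resL_apply, map_add]
    rfl
  rw [L_neg_one_res, 𝒱.L_zero_res hu, h₂, eq_sub_of_add_eq h₁.symm]
  module

end Virasoro

/-! ### The star products as bilinear maps and their coefficients. -/

section Star

variable (n m p : ℕ)

/-- The product `u *_{m,p}^n v`, for `u` of weight `k`, as a bilinear map. -/
noncomputable def starHomL (k : ℤ) : V →ₗ[ℂ] V →ₗ[ℂ] V :=
  ∑ i ∈ Finset.range (p + 1),
    ((-1 : ℤ) ^ i * Ring.choose ((m : ℤ) + n - p + i) i) • 𝒱.resL (k + m) ((m : ℤ) + n - p + i + 1)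

theorem starHomL_apply (k : ℤ) (u v : V) :
    𝒱.starHomL n m p k u v = 𝒱.starHom n m p k u v := by
  simp only [starHomL, starHom, LinearMap.sum_apply, LinearMap.smul_apply, resL_apply]

theorem finite_support_starHom (u v : V) :
    (Function.support fun k ↦ 𝒱.starHom n m p k (𝒱.component k u) v).Finite := by
  refine (𝒱.finite_support_component u).subset fun k hk h ↦ hk ?_
  simp only
  rw [h, ← starHomL_apply, map_zero, LinearMap.zero_apply]

/-- The product `u *_{m,p}^n v` as a bilinear map. -/
noncomputable def starL : V →ₗ[ℂ] V →ₗ[ℂ] V :=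
  LinearMap.mk₂ ℂ (𝒱.star n m p)
    (fun u u' v ↦ by
      simp only [star]
      rw [← finsum_add_distrib (𝒱.finite_support_starHom _ _ _ _ _)
        (𝒱.finite_support_starHom _ _ _ _ _)]
      simp only [← starHomL_apply, component_add, map_add, LinearMap.add_apply])
    (fun c u v ↦ by
      simp only [star]
      rw [smul_finsum' c (𝒱.finite_support_starHom _ _ _ _ _)]
      simp only [← starHomL_apply, component_smul, map_smul, LinearMap.smul_apply])
    (fun u v v' ↦ by
      simp only [star]
      rw [← finsum_add_distrib (𝒱.finite_support_starHom _ _ _ _ _)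
        (𝒱.finite_support_starHom _ _ _ _ _)]
      simp only [← starHomL_apply, map_add])
    (fun c u v ↦ by
      simp only [star]
      rw [smul_finsum' c (𝒱.finite_support_starHom _ _ _ _ _)]
      simp only [← starHomL_apply, map_smul])

theorem starL_apply (u v : V) : 𝒱.starL n m p u v = 𝒱.star n m p u v := rfl

variable {n m p}

theorem star_of_mem {k : ℤ} {u : V} (hu : u ∈ 𝒱.grade k) (v : V) :
    𝒱.star n m p u v = 𝒱.starHom n m p k u v := by
  rw [star, finsum_eq_single _ k, 𝒱.component_of_mem hu]
  intro j hj
  rw [𝒱.component_of_mem_ne hu hj.symm, ← starHomL_apply, map_zero, LinearMap.zero_apply]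

end Star

/-- The coefficient `(-1)^i (m+i choose i)`. -/
noncomputable def starCoeff (m i : ℕ) : ℂ := (-1) ^ i * ((m + i).choose i : ℂ)

theorem starCoeff_succ_mul (m i : ℕ) :
    starCoeff m (i + 1) * (i + 1) = -(starCoeff m i * (m + i + 1)) := by
  have h := Nat.add_one_mul_choose_eq (m + i) i
  have h' : ((m : ℂ) + i + 1) * ((m + i).choose i : ℂ) =
      ((m + (i + 1)).choose (i + 1) : ℂ) * (i + 1) := by exact_mod_cast h
  rw [starCoeff, starCoeff, pow_succ]
  linear_combination (-(-1 : ℂ) ^ i) * -h'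

/-- By `starCoeff_succ_mul` neighbouring terms cancel. When `E` is a family of residues, the
surviving boundary term is a multiple of u ∘ v. -/
theorem sum_starCoeff_telescope {W : Type*} [AddCommGroup W] [Module ℂ W] (m N : ℕ) (E : ℕ → W) :
    ∑ i ∈ Finset.range (N + 1),
      starCoeff m i • (((m : ℂ) + i + 1) • E (i + 1) + (i : ℂ) • E i) =
    (starCoeff m N * (m + N + 1)) • E (N + 1) := by
  induction N with
  | zero => simp [mul_smul]
  | succ N ih =>
    rw [Finset.sum_range_succ, ih]
    have := starCoeff_succ_mul m N
    rw [show starCoeff m N * (m + N + 1) = -(starCoeff m (N + 1) * (N + 1)) by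
      rw [this, neg_neg]]
    push_cast
    module

theorem zsmul_eq_starCoeff_smul {W : Type*} [AddCommGroup W] [Module ℂ W] (m i : ℕ) {x : ℤ}
    (hx : x = m + i) (w : W) :
    ((-1 : ℤ) ^ i * Ring.choose x i) • w = starCoeff m i • w := by
  rw [hx, show (m : ℤ) + i = ((m + i : ℕ) : ℤ) by push_cast; rfl, Ring.choose_natCast, starCoeff,
    ← Int.cast_smul_eq_zsmul ℂ]
  push_cast
  rfl

theorem star_left_eq {n m : ℕ} {k : ℤ} {u : V} (hu : u ∈ 𝒱.grade k) (v : V) :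
    𝒱.star n m n u v =
      ∑ i ∈ Finset.range (n + 1), starCoeff m i • 𝒱.res (k + m) (m + i + 1) u v := by
  rw [𝒱.star_of_mem hu, starHom]
  refine Finset.sum_congr rfl fun i _ ↦ ?_
  rw [add_sub_cancel_right]
  exact zsmul_eq_starCoeff_smul m i rfl _

theorem star_right_eq {n m : ℕ} {k : ℤ} {u : V} (hu : u ∈ 𝒱.grade k) (v : V) :
    𝒱.star n m m u v =
      ∑ i ∈ Finset.range (m + 1), starCoeff n i • 𝒱.res (k + m) (n + i + 1) u v := by
  rw [𝒱.star_of_mem hu, starHom]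
  refine Finset.sum_congr rfl fun i _ ↦ ?_
  rw [add_sub_cancel_left]
  exact zsmul_eq_starCoeff_smul n i rfl _

/-! ### Stability of O'_{n,m} under both actions. -/

section O₁

variable {n m : ℕ}

theorem circHom_mem_O₁ {k : ℤ} {u : V} (hu : u ∈ 𝒱.grade k) (v : V) :
    𝒱.res (k + m) (n + m + 2) u v ∈ 𝒱.O₁ n m :=
  Submodule.subset_span (Or.inl ⟨k, u, v, hu, rfl⟩)

theorem L_neg_one_add_mem_O₁ (u : V) :
    𝒱.L (-1) u + (𝒱.L 0 u + ((m : ℂ) - n) • u) ∈ 𝒱.O₁ n m :=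
  Submodule.subset_span (Or.inr ⟨u, rfl⟩)

/-- Replacing u by L(-1)u deepens the pole by one, up to a term already known to lie in O'; the
coefficient n + m + 2 + l is nonzero. -/
theorem res_add_natCast_mem_O₁ {k : ℤ} {u : V} (hu : u ∈ 𝒱.grade k) (v : V) (l : ℕ) :
    𝒱.res (k + m) (n + m + 2 + l) u v ∈ 𝒱.O₁ n m := by
  induction l generalizing k u with
  | zero => simpa using 𝒱.circHom_mem_O₁ hu v
  | succ l ih =>
    have h := ih (𝒱.L_neg_one_mem_grade hu)
    rw [add_right_comm, res_succ_L_neg_one] at h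
    have h' := (Submodule.add_mem_iff_left _ (Submodule.smul_mem _ _ (ih hu))).1 h
    rw [Submodule.smul_mem_iff _ (by norm_cast; omega)] at h'
    push_cast
    rwa [← add_assoc]

/-- The standard criterion for a residue to be in `O'_{n,m}(V)`. -/
theorem res_mem_O₁ {k : ℤ} {u : V} (hu : u ∈ 𝒱.grade k) (v : V) {a b : ℤ} (ha : k + m ≤ a)
    (hab : a - (k + m) ≤ b - (n + m + 2)) : 𝒱.res a b u v ∈ 𝒱.O₁ n m := by
  obtain ⟨s, rfl⟩ := Int.exists_add_of_le ha
  induction s generalizing b with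
  | zero =>
    obtain ⟨l, hl⟩ := Int.exists_add_of_le (show (n : ℤ) + m + 2 ≤ b by simp at hab; omega)
    rw [hl, Nat.cast_zero, add_zero]
    exact 𝒱.res_add_natCast_mem_O₁ hu v l
  | succ s ih =>
    push_cast at hab ⊢
    rw [← add_assoc, res_succ]
    exact add_mem (ih (by omega) (by omega)) (ih (by omega) (by omega))

/-- Jacobi with r = 0 swaps the residues. The swapped product is a ∘-product with u, up to sign of
the commutator terms: those involve u_{j+q}v, whose exponent excess m+q+1 is at most the pole excess
m+i+q+1. -/
theorem res_circ_mem_O₁ {k l : ℤ} {u v : V} (hu : u ∈ 𝒱.grade k) (hv : v ∈ 𝒱.grade l) (w : V)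
    (i : ℕ) : 𝒱.res (k + m) (m + i + 1) u (𝒱.res (l + m) (n + m + 2) v w) ∈ 𝒱.O₁ n m := by
  have h := 𝒱.iterateSide_eq u v w 0 (k + m) (m + i + 1) (l + m) (n + m + 2)
  simp only [productSide, chooseSum_zero_left, Int.negOnePow_zero, Units.val_one, one_smul,
    pow_zero, Nat.cast_zero, sub_zero, add_zero] at h
  rw [← sub_add_cancel (𝒱.res (k + m) _ u _), ← h]
  refine add_mem (chooseSum_mem (S := (𝒱.O₁ n m).toAddSubgroup) (fun j ↦
    chooseSum_mem (fun q ↦ ?_) _) _) (𝒱.circHom_mem_O₁ hv _)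
  exact 𝒱.res_mem_O₁ (𝒱.mode_mem_grade hu hv _) w (by omega) (by omega)

/-- `V *̄_m^n O'_{n,m}(V) ⊆ O'_{n,m}(V)`. -/
theorem star_left_mem_O₁ (u : V) {x : V} (hx : x ∈ 𝒱.O₁ n m) : 𝒱.star n m n u x ∈ 𝒱.O₁ n m := by
  induction u using 𝒱.homogeneous_induction with
  | add u u' h h' =>
    rw [← starL_apply, map_add, LinearMap.add_apply]
    exact add_mem h h'
  | hom k u hu =>
    suffices 𝒱.O₁ n m ≤ (𝒱.O₁ n m).comap (𝒱.starL n m n u) from this hx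
    refine Submodule.span_le.2 ?_
    rintro _ (⟨l, v, w, hv, rfl⟩ | ⟨v, rfl⟩)
    · rw [SetLike.mem_coe, Submodule.mem_comap, starL_apply, 𝒱.star_left_eq hu]
      exact sum_mem fun i _ ↦ Submodule.smul_mem _ _ (𝒱.res_circ_mem_O₁ hu hv w i)
    · rw [SetLike.mem_coe, Submodule.mem_comap, starL_apply]
      -- L(-1) + L(0) + m - n commutes with u *̄ up to the telescoped boundary term, a multiple of u
      -- ∘ v.
      have key : 𝒱.L (-1) (𝒱.star n m n u v) +
          (𝒱.L 0 (𝒱.star n m n u v) + ((m : ℂ) - n) • 𝒱.star n m n u v) =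
          𝒱.star n m n u (𝒱.L (-1) v + (𝒱.L 0 v + ((m : ℂ) - n) • v)) +
          (starCoeff m n * (m + n + 1)) • 𝒱.res (k + m) (n + m + 2) u v := by
        have tel := sum_starCoeff_telescope m n fun i ↦ 𝒱.res (k + m) (m + i + 1) u v
        rw [show (m : ℤ) + (n + 1 : ℕ) + 1 = n + m + 2 by push_cast; ring] at tel
        rw [← tel]
        simp only [𝒱.star_left_eq hu, map_sum, Finset.smul_sum, ← Finset.sum_add_distrib]
        refine Finset.sum_congr rfl fun i _ ↦ ?_
        have h := 𝒱.L_neg_one_add_L_zero_res hu (k + m) (m + i + 1) v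
        simp only [map_smul]
        rw [← add_assoc (𝒱.L (-1) v), ← resL_apply _ _ _ _ (_ + _), map_add, map_smul, resL_apply,
          resL_apply, eq_sub_of_add_eq (eq_sub_of_add_eq h.symm)]
        push_cast
        rw [← add_assoc (m : ℤ)]
        module
      rw [← add_sub_cancel_right (𝒱.star n m n u _), ← key]
      exact sub_mem (𝒱.L_neg_one_add_mem_O₁ _)
        (Submodule.smul_mem _ _ (𝒱.circHom_mem_O₁ hu v))

/-- Since u_{j-b}v has weight k+l-j+b-1, its factor (1+z₂)^{wt+m} splits as (1+z₂)^{k+m-j}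
(1+z₂)^{l+b-1}. The first part comes from expanding (1+z₁)^{k+m}, hence the exponent l+b-1 for z₂.
-/
theorem star_right_res {k l : ℤ} {u v : V} (hu : u ∈ 𝒱.grade k) (hv : v ∈ 𝒱.grade l) (w : V)
    (b : ℤ) :
    𝒱.star n m m (𝒱.res (k + m) b u v) w = ∑ i ∈ Finset.range (m + 1),
      starCoeff n i • 𝒱.iterateSide u v w (-b) (k + m) 0 (l + b - 1) (n + i + 1) := by
  have h₀ (i : ℕ) : ∀ᶠ j : ℕ in atTop,
      𝒱.res (k + m + (l + b - 1) - j) (n + i + 1) (ncoeff (𝒱.Y u) (j - b) v) w = 0 := by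
    filter_upwards [𝒱.eventually_mode_sub_eq_zero u v b] with j hj
    rw [hj, res_zero_left]
  have h₁ := chooseSum_map (𝒱.eventually_mode_sub_eq_zero u v b)
    ((𝒱.starL n m m).flip w).toAddMonoidHom (k + m)
  refine h₁.trans ?_
  have h₂ (i : ℕ) : starCoeff n i • 𝒱.iterateSide u v w (-b) (k + m) 0 (l + b - 1) (n + i + 1) =
      chooseSum (k + m) fun j ↦ starCoeff n i •
        𝒱.res (k + m + (l + b - 1) - j) (n + i + 1) (ncoeff (𝒱.Y u) (j - b) v) w := by
    refine Eq.trans ?_ (chooseSum_map (h₀ i) (DistribSMul.toAddMonoidHom V (starCoeff n i)) _)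
    simp only [iterateSide, neg_zero, chooseSum_zero_left, Nat.cast_zero, zero_add, add_zero]
    simp only [neg_add_eq_sub]
    rfl
  simp only [h₂]
  rw [← chooseSum_sum]
  · congr 1 with j
    refine (𝒱.star_right_eq (𝒱.mode_mem_grade hu hv _) w).trans ?_
    refine Finset.sum_congr rfl fun i _ ↦ ?_
    rw [show k + l - (j - b) - 1 + m = k + m + (l + b - 1) - j by ring]
  · intro i _
    filter_upwards [h₀ i] with j hj
    rw [hj, smul_zero]

/-- `O'_{n,m}(V) *_m^n V ⊆ O'_{n,m}(V)`. -/
theorem star_right_mem_O₁ {x : V} (hx : x ∈ 𝒱.O₁ n m) (w : V) : 𝒱.star n m m x w ∈ 𝒱.O₁ n m := by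
  suffices 𝒱.O₁ n m ≤ (𝒱.O₁ n m).comap ((𝒱.starL n m m).flip w) from this hx
  refine Submodule.span_le.2 ?_
  rintro _ (⟨k, u, v, hu, rfl⟩ | ⟨u, rfl⟩)
  · rw [SetLike.mem_coe, Submodule.mem_comap]
    change 𝒱.star n m m (𝒱.res (k + m) (n + m + 2) u v) w ∈ _
    induction v using 𝒱.homogeneous_induction with
    | add v v' h h' =>
      rw [← resL_apply, map_add, ← starL_apply, map_add, LinearMap.add_apply]
      exact add_mem h h'
    | hom l v hv =>
      rw [𝒱.star_right_res hu hv]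
      refine sum_mem fun i _ ↦ Submodule.smul_mem _ _ ?_
      -- With r = -(n+m+2), the outer residue of either product has a deep enough pole.
      rw [iterateSide_eq]
      refine sub_mem ?_ (zsmul_mem ?_ _)
      · refine chooseSum_mem (S := (𝒱.O₁ n m).toAddSubgroup) (fun q ↦ zsmul_mem ?_ _) _
        exact 𝒱.res_mem_O₁ hu _ le_rfl (by omega)
      · refine chooseSum_mem (S := (𝒱.O₁ n m).toAddSubgroup) (fun q ↦ zsmul_mem ?_ _) _
        exact 𝒱.res_mem_O₁ hv _ (by omega) (by omega)
  · rw [SetLike.mem_coe, Submodule.mem_comap]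
    induction u using 𝒱.homogeneous_induction with
    | add u u' h h' =>
      convert add_mem h h' using 1
      simp only [map_add, smul_add]
      abel
    | hom k u hu =>
      rw [L_zero_apply, 𝒱.L_zero_grade k u hu, ← add_smul, map_add, map_smul, LinearMap.flip_apply,
        LinearMap.flip_apply, starL_apply, starL_apply, 𝒱.star_right_eq hu,
        𝒱.star_right_eq (𝒱.L_neg_one_mem_grade hu), Finset.smul_sum, ← Finset.sum_add_distrib]
      have tel := sum_starCoeff_telescope n m fun i ↦ 𝒱.res (k + m) (n + i + 1) u w
      rw [show (n : ℤ) + (m + 1 : ℕ) + 1 = n + m + 2 by push_cast; ring] at tel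
      convert Submodule.smul_mem _ (starCoeff n m * (n + m + 1))
        (𝒱.circHom_mem_O₁ (n := n) hu w) using 1
      refine Eq.trans (Finset.sum_congr rfl fun i _ ↦ ?_) tel
      rw [add_right_comm k, res_succ_L_neg_one]
      push_cast
      rw [← add_assoc (n : ℤ)]
      module

end O₁

/-! ### Associativity of *_n modulo O_n. -/

/-- The expansion of `(z - (1 + z))^p` as an identity of residues. -/
theorem sum_antidiagonal_alternating (p : ℕ) (x y : ℤ) (u v : V) :
    ∑ ij ∈ Finset.HasAntidiagonal.antidiagonal p,
      ((-1) ^ ij.1 * (p.choose ij.1 : ℂ)) • 𝒱.res (x + ij.1) (y - ij.2) u v =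
    (-1 : ℂ) ^ p • 𝒱.res x y u v := by
  induction p with
  | zero => simp
  | succ p ih =>
    have h := Finset.sum_antidiagonal_choose_succ_nsmul
      (fun i j ↦ (-1 : ℂ) ^ i • 𝒱.res (x + i) (y - j) u v) p
    rw [← Finset.sum_add_distrib] at h
    rw [pow_succ, mul_comm, mul_smul, ← ih, Finset.smul_sum]
    convert h using 1
    · refine Finset.sum_congr rfl fun ij _ ↦ ?_
      rw [mul_comm, mul_smul, Nat.cast_smul_eq_nsmul]
    · refine Finset.sum_congr rfl fun ij hij ↦ ?_
      rw [Nat.choose_symm_of_eq_add (Finset.HasAntidiagonal.mem_antidiagonal.1 hij).symm]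
      have h' := 𝒱.res_succ (x + ij.1) (y - ij.2) u v
      push_cast
      rw [← add_assoc x, ← sub_sub y, h', ← Nat.cast_smul_eq_nsmul ℂ,
        ← Nat.cast_smul_eq_nsmul ℂ, pow_succ]
      module

theorem choose_neg_mul_neg_one_pow (N q : ℕ) :
    Ring.choose (-((N : ℤ) + 1)) q * (-1) ^ q = ((N + q).choose q : ℤ) := by
  rw [Ring.choose_neg, show (N : ℤ) + 1 + q - 1 = ((N + q : ℕ) : ℤ) by push_cast; ring,
    Ring.choose_natCast, Units.smul_def, Int.negOnePow_def]
  simp only [zpow_natCast, Units.val_pow_eq_pow_val, Units.val_neg, Units.val_one, smul_eq_mul]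
  rw [mul_right_comm, ← mul_pow]
  simp

/-- Splits off a factor depending only on i + q, so that the remaining sum over i is an alternating
binomial sum. -/
theorem starCoeff_mul_choose (n i q : ℕ) :
    starCoeff n i * ((n + i + q).choose q : ℂ) =
      ((n + (i + q)).choose (i + q) : ℂ) * ((-1) ^ i * ((i + q).choose i : ℂ)) := by
  have h : (n + i).choose i * (n + i + q).choose q =
      (n + (i + q)).choose (i + q) * (i + q).choose i := by
    have := Nat.choose_mul (n := n + (i + q)) (k := i + q) (s := q) (by omega)
    rw [Nat.choose_symm_of_eq_add (show i + q = i + q from rfl), this, mul_comm]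
    congr 2 <;> omega
  have h' : ((n + i).choose i : ℂ) * ((n + i + q).choose q : ℂ) =
      ((n + (i + q)).choose (i + q) : ℂ) * ((i + q).choose i : ℂ) := by exact_mod_cast h
  rw [starCoeff]
  linear_combination (-1 : ℂ) ^ i * h'

variable {n : ℕ}

/-- In the Jacobi identity with r = -(n+i+1), the product with b outside lies in O_n, as do the
terms with i + q > n of the other product. -/
theorem iterateSide_sub_mem_O₁ {k l : ℤ} {a b : V} (ha : a ∈ 𝒱.grade k) (hb : b ∈ 𝒱.grade l)
    (c : V) (i j : ℕ) (hi : i ≤ n) :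
    𝒱.iterateSide a b c (-(n + i + 1)) (k + n) 0 (l + n + i) (n + j + 1) -
      ∑ q ∈ Finset.range (n + 1 - i), ((n + i + q).choose q : ℂ) •
        𝒱.res (k + n) (n + (i + q : ℕ) + 1) a (𝒱.res (l + n + i) (n + j + 1 - q) b c) ∈
      𝒱.O₁ n n := by
  have h₁ := chooseSum_sub_sum_mem (S := (𝒱.O₁ n n).toAddSubgroup)
    ((𝒱.eventually_productSide_eq_zero a b c (-(n + i + 1)) (n + j + 1)).mono
      fun q hq ↦ hq (k + n) 0 (l + n + i)) (M := n + 1 - i) (fun q hq ↦ zsmul_mem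
        (𝒱.res_mem_O₁ ha _ le_rfl (by omega)) _) (-(n + i + 1))
  have h₂ : 𝒱.productSide b a c (-(n + i + 1)) (l + n + i) (n + j + 1) (k + n) 0 ∈ 𝒱.O₁ n n :=
    chooseSum_mem (S := (𝒱.O₁ n n).toAddSubgroup) (fun q ↦ zsmul_mem
      (𝒱.res_mem_O₁ hb _ (by omega) (by omega)) _) _
  rw [iterateSide_eq, sub_right_comm]
  refine sub_mem ?_ (zsmul_mem h₂ _)
  suffices h : ∀ q : ℕ, ((n + i + q).choose q : ℂ) • 𝒱.res (k + n) (n + (i + q : ℕ) + 1) a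
      (𝒱.res (l + n + i) (n + j + 1 - q) b c) = Ring.choose (-((n : ℤ) + i + 1)) q •
        (-1 : ℤ) ^ q • 𝒱.res (k + n) (0 - -((n : ℤ) + i + 1) + q) a
          (𝒱.res (l + n + i) (n + j + 1 - q) b c) by
    rw [Finset.sum_congr rfl fun q _ ↦ h q]
    exact h₁
  intro q
  have hc := choose_neg_mul_neg_one_pow (n + i) q
  push_cast at hc
  rw [smul_smul, hc, zero_sub, neg_neg, ← Int.cast_smul_eq_zsmul ℂ]
  push_cast
  rw [show (n : ℤ) + (i + q) + 1 = n + i + 1 + q by ring]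

/-- Associativity of `*_n` modulo `O_n(V)`. -/
theorem star_assoc_sub_mem_O₁ (a b c : V) :
    𝒱.star n n n (𝒱.star n n n a b) c - 𝒱.star n n n a (𝒱.star n n n b c) ∈ 𝒱.O₁ n n := by
  induction a using 𝒱.homogeneous_induction with
  | add a a' h h' =>
    convert add_mem h h' using 1
    simp only [← starL_apply, map_add, LinearMap.add_apply]
    abel
  | hom k a ha =>
  induction b using 𝒱.homogeneous_induction with
  | add b b' h h' =>
    convert add_mem h h' using 1
    simp only [← starL_apply, map_add, LinearMap.add_apply]
    abel
  | hom l b hb =>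
  have h₁ : 𝒱.star n n n (𝒱.star n n n a b) c = ∑ i ∈ Finset.range (n + 1),
      ∑ j ∈ Finset.range (n + 1), (starCoeff n i * starCoeff n j) •
        𝒱.iterateSide a b c (-(n + i + 1)) (k + n) 0 (l + n + i) (n + j + 1) := by
    rw [𝒱.star_right_eq ha, ← starL_apply, map_sum, LinearMap.sum_apply]
    refine Finset.sum_congr rfl fun i _ ↦ ?_
    rw [map_smul, LinearMap.smul_apply, starL_apply, 𝒱.star_right_res ha hb, Finset.smul_sum]
    refine Finset.sum_congr rfl fun j _ ↦ ?_
    rw [smul_smul, show l + (n + (i : ℤ) + 1) - 1 = l + n + i by ring]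
  have h₂ : 𝒱.star n n n a (𝒱.star n n n b c) = ∑ i ∈ Finset.range (n + 1),
      ∑ j ∈ Finset.range (n + 1), (starCoeff n i * starCoeff n j) •
        ∑ q ∈ Finset.range (n + 1 - i), ((n + i + q).choose q : ℂ) •
          𝒱.res (k + n) (n + (i + q : ℕ) + 1) a (𝒱.res (l + n + i) (n + j + 1 - q) b c) := by
    rw [𝒱.star_right_eq hb, 𝒱.star_right_eq ha, Finset.sum_comm]
    simp only [← resL_apply, map_sum, map_smul, Finset.smul_sum]
    rw [Finset.sum_comm]
    refine Finset.sum_congr rfl fun j _ ↦ ?_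
    -- Regroup by p = i + q, which fixes the outer residue; the inner sum is then the expansion of
    -- (z - (1+z))^p = (-1)^p.
    rw [← Finset.sum_range_diag_flip (n + 1) fun i q ↦ (starCoeff n i * starCoeff n j) •
      ((n + i + q).choose q : ℂ) • 𝒱.resL (k + n) (n + (i + q : ℕ) + 1) a
        (𝒱.resL (l + n + i) (n + j + 1 - q) b c)]
    refine Finset.sum_congr rfl fun p _ ↦ ?_
    have hp := 𝒱.sum_antidiagonal_alternating p (l + n) (n + j + 1) b c
    replace hp := congrArg (𝒱.resL (k + n) (n + p + 1) a) hp
    rw [map_smul, map_sum] at hp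
    rw [Finset.Nat.sum_antidiagonal_eq_sum_range_succ_mk] at hp
    have hr : ∀ i ∈ Finset.range (p + 1), (starCoeff n i * starCoeff n j) •
        ((n + i + (p - i)).choose (p - i) : ℂ) • 𝒱.resL (k + n) (n + (i + (p - i) : ℕ) + 1) a
          (𝒱.resL (l + n + i) (n + j + 1 - (p - i : ℕ)) b c) =
        (starCoeff n j * ((n + p).choose p : ℂ)) • 𝒱.resL (k + n) (n + p + 1) a
          (((-1 : ℂ) ^ i * (p.choose i : ℂ)) •
            𝒱.res (l + n + i) (n + j + 1 - (p - i : ℕ)) b c) := by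
      intro i hi
      have hip : i + (p - i) = p := by
        have := Finset.mem_range.1 hi
        omega
      have hc := starCoeff_mul_choose n i (p - i)
      rw [hip] at hc ⊢
      rw [smul_smul, mul_right_comm, hc, map_smul, smul_smul, resL_apply]
      congr 1
      ring
    rw [Finset.sum_congr rfl hr, ← Finset.smul_sum, hp, starCoeff, smul_smul, smul_smul]
    simp only [resL_apply]
    congr 1
    ring
  rw [h₁, h₂, ← Finset.sum_sub_distrib]
  refine sum_mem fun i hi ↦ ?_
  rw [← Finset.sum_sub_distrib]
  refine sum_mem fun j _ ↦ ?_
  rw [← smul_sub]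
  exact Submodule.smul_mem _ _
    (𝒱.iterateSide_sub_mem_O₁ ha hb c i j (by simpa [Nat.lt_succ_iff] using hi))

/-! ### The vacuum as identity. -/

section Identity

variable {n m : ℕ}

theorem sum_starCoeff_mul_choose (m n N : ℕ) :
    ∑ i ∈ Finset.range (N + 1), starCoeff m i * (n.choose (n + i) : ℂ) = 1 := by
  rw [Finset.sum_range_succ', Finset.sum_eq_zero]
  · simp [starCoeff]
  · intro i _
    rw [Nat.choose_eq_zero_of_lt (by omega), Nat.cast_zero, mul_zero]

/-- The vacuum is a left identity for `*̄_m^n` on the nose. -/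
theorem star_vac_left (v : V) : 𝒱.star n m n 𝒱.vac v = v := by
  rw [𝒱.star_left_eq 𝒱.vac_mem_grade]
  have h (i : ℕ) : 𝒱.res (0 + m) (m + i + 1) 𝒱.vac v = (m.choose (m + i) : ℂ) • v := by
    rw [res_eq_chooseSum, chooseSum, finsum_eq_single _ (m + i)]
    · rw [𝒱.vac_mode, if_pos (by push_cast; ring), zero_add, Ring.choose_natCast,
        ← Int.cast_smul_eq_zsmul ℂ, Int.cast_natCast]
    · intro j hj
      rw [𝒱.vac_mode, if_neg (by omega), smul_zero]
  simp only [h, smul_smul]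
  rw [← Finset.sum_smul, sum_starCoeff_mul_choose, one_smul]

theorem succ_mul_choose_succ (r : ℤ) (j : ℕ) :
    ((j : ℤ) + 1) * Ring.choose r (j + 1) = r * Ring.choose (r - 1) j := by
  have h := Ring.choose_smul_choose r (n := j + 1) (k := 1) (by omega)
  rw [Nat.choose_one_right, Ring.choose_one_right, Nat.add_sub_cancel, nsmul_eq_mul] at h
  push_cast at h
  exact h

/-- Modulo `O'_{n,m}(V)`, `Y(x, z)𝟏 = e^{zL(-1)} x` is `(1 + z)^{n - m - wt x} x`. -/
theorem mode_vac_sub_mem_O₁ {k : ℤ} {x : V} (hx : x ∈ 𝒱.grade k) (j : ℕ) :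
    ncoeff (𝒱.Y x) (-1 - j) 𝒱.vac - Ring.choose ((n : ℤ) - m - k) j • x ∈ 𝒱.O₁ n m := by
  induction j generalizing k x with
  | zero => simp [𝒱.creation]
  | succ j ih =>
    have h := ih (𝒱.L_neg_one_mem_grade hx)
    rw [L_neg_one_apply, 𝒱.L_neg_one_deriv, ← L_neg_one_apply] at h
    have hL := 𝒱.L_neg_one_add_mem_O₁ (n := n) (m := m) x
    rw [L_zero_apply, 𝒱.L_zero_grade k x hx] at hL
    -- Mode -1-j of L(-1)x is j + 1 times mode -2-j of x, so the claim is proved after scaling by j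
    -- + 1.
    rw [← Submodule.smul_mem_iff _ (show ((j : ℂ) + 1) ≠ 0 by norm_cast)]
    convert add_mem h (zsmul_mem hL (Ring.choose ((n : ℤ) - m - (k + 1)) j)) using 1
    have hc := succ_mul_choose_succ ((n : ℤ) - m - k) j
    rw [sub_sub _ k] at hc
    have hc' := congrArg (Int.cast : ℤ → ℂ) hc
    push_cast at hc'
    simp only [← Int.cast_smul_eq_zsmul ℂ, smul_sub, smul_smul]
    rw [hc']
    push_cast
    rw [← sub_sub (-1 : ℤ)]
    module

/-- The vacuum is a right identity for `*_m^n` modulo `O'_{n,m}(V)`. -/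
theorem star_vac_right_sub_mem_O₁ (x : V) : 𝒱.star n m m x 𝒱.vac - x ∈ 𝒱.O₁ n m := by
  induction x using 𝒱.homogeneous_induction with
  | add x y hx hy =>
    convert add_mem hx hy using 1
    rw [← starL_apply, map_add, LinearMap.add_apply]
    simp only [starL_apply]
    abel
  | hom k x hx =>
    have h (i : ℕ) : 𝒱.res (k + m) (n + i + 1) x 𝒱.vac - (n.choose (n + i) : ℂ) • x ∈
        𝒱.O₁ n m := by
      -- Vandermonde for (1+z)^{k+m} (1+z)^{n-m-k} = (1+z)^n, at z^{n+i}.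
      have hv := Ring.add_choose_eq (r := k + (m : ℤ)) (s := (n : ℤ) - m - k) (n + i)
        (Commute.all _ _)
      rw [show k + (m : ℤ) + (n - m - k) = n by ring, Ring.choose_natCast,
        Finset.Nat.sum_antidiagonal_eq_sum_range_succ_mk] at hv
      rw [res_eq_chooseSum, chooseSum_eq_sum_range (N := n + i + 1) (fun j hj ↦
        𝒱.creation_regular _ _ (by omega)), show (n.choose (n + i) : ℂ) • x =
          (n.choose (n + i) : ℤ) • x by rw [← Int.cast_smul_eq_zsmul ℂ, Int.cast_natCast], hv,
        Finset.sum_smul, ← Finset.sum_sub_distrib]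
      refine sum_mem fun j hj ↦ ?_
      rw [mul_smul, ← smul_sub]
      have hj' := Finset.mem_range.1 hj
      rw [show (j : ℤ) - (n + i + 1) = -1 - ((n + i - j : ℕ) : ℤ) by omega]
      exact zsmul_mem (𝒱.mode_vac_sub_mem_O₁ hx _) _
    rw [𝒱.star_right_eq hx]
    have hs := Finset.sum_smul (R := ℂ) (s := Finset.range (m + 1))
      (f := fun i ↦ starCoeff n i * (n.choose (n + i) : ℂ)) (x := x)
    rw [sum_starCoeff_mul_choose, one_smul] at hs
    nth_rw 2 [hs]
    rw [← Finset.sum_sub_distrib]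
    refine sum_mem fun i _ ↦ ?_
    rw [mul_smul, ← smul_sub]
    exact Submodule.smul_mem _ _ (h i)

end Identity

/-! ### Formal stability of O'' and O'''. -/

section Bimodule

variable {n m : ℕ}

theorem O₁_le_O : 𝒱.O₁ n m ≤ 𝒱.O n m := le_sup_left.trans le_sup_left

theorem O₂_le_O : 𝒱.O₂ n m ≤ 𝒱.O n m := le_sup_right.trans le_sup_left

theorem O₃_le_O : 𝒱.O₃ n m ≤ 𝒱.O n m := le_sup_right

/-- The associator `(a *_{p₁,p₂}^{p₃} b) *_{m,p₁}^{p₃} c - a *_{m,p₂}^{p₃} (b *_{m,p₁}^{p₂} c)`. -/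
noncomputable def associator (m p₁ p₂ p₃ : ℕ) (a b c : V) : V :=
  𝒱.star p₃ m p₁ (𝒱.star p₃ p₁ p₂ a b) c - 𝒱.star p₃ m p₂ a (𝒱.star p₂ m p₁ b c)

theorem star_associator_mem_O₂ (p₁ p₂ p₃ : ℕ) (a b c u : V) :
    𝒱.star n m p₃ u (𝒱.associator m p₁ p₂ p₃ a b c) ∈ 𝒱.O₂ n m :=
  Submodule.subset_span ⟨a, b, c, u, p₁, p₂, p₃, rfl⟩

/-- The outer factor in O'' may be the vacuum, an exact left identity. -/
theorem associator_mem_O₂ (p₁ p₂ : ℕ) (a b c : V) :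
    𝒱.associator m p₁ p₂ n a b c ∈ 𝒱.O₂ n m := by
  rw [← 𝒱.star_vac_left (n := n) (m := m) (𝒱.associator m p₁ p₂ n a b c)]
  exact 𝒱.star_associator_mem_O₂ p₁ p₂ n a b c 𝒱.vac

/-- `V *_{m,p}^n O''_{p,m}(V) ⊆ O''_{n,m}(V)`. -/
theorem star_mem_O₂ {p : ℕ} (u : V) {x : V} (hx : x ∈ 𝒱.O₂ p m) : 𝒱.star n m p u x ∈ 𝒱.O₂ n m := by
  suffices 𝒱.O₂ p m ≤ (𝒱.O₂ n m).comap (𝒱.starL n m p u) from this hx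
  refine Submodule.span_le.2 ?_
  rintro _ ⟨a, b, c, w, p₁, p₂, p₃, rfl⟩
  rw [SetLike.mem_coe, Submodule.mem_comap, starL_apply]
  -- u(wX) is (uw)X minus an associator, for X itself an associator.
  have h := sub_mem (𝒱.star_associator_mem_O₂ (n := n) (m := m) p₁ p₂ p₃ a b c (𝒱.star n p₃ p u w))
    (𝒱.associator_mem_O₂ (n := n) p₃ p u w (𝒱.associator m p₁ p₂ p₃ a b c))
  rwa [associator, associator, sub_sub_cancel] at h

/-- The pentagon relation: `((a b) c) d - (a (b c)) d` is a combination of associators. -/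
theorem star_associator_left_mem_O₂ (p₀ p₁ p₂ : ℕ) (a b c d : V) :
    𝒱.star n m p₀ (𝒱.associator p₀ p₁ p₂ n a b c) d ∈ 𝒱.O₂ n m := by
  have h₁ := 𝒱.associator_mem_O₂ (n := n) (m := m) p₀ p₁ (𝒱.star n p₁ p₂ a b) c d
  have h₂ := 𝒱.associator_mem_O₂ (n := n) (m := m) p₁ p₂ a b (𝒱.star p₁ m p₀ c d)
  have h₃ := 𝒱.associator_mem_O₂ (n := n) (m := m) p₀ p₂ a (𝒱.star p₂ p₀ p₁ b c) d
  have h₄ := 𝒱.star_associator_mem_O₂ (n := n) (m := m) p₀ p₁ p₂ b c d a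
  convert sub_mem (add_mem h₁ h₂) (add_mem h₃ h₄) using 1
  simp only [associator, ← starL_apply, map_sub, LinearMap.sub_apply]
  abel

/-- `O''_{n,p}(V) *_{m,p}^n V ⊆ O''_{n,m}(V)`. -/
theorem star_right_mem_O₂ {p : ℕ} {x : V} (hx : x ∈ 𝒱.O₂ n p) (v : V) :
    𝒱.star n m p x v ∈ 𝒱.O₂ n m := by
  suffices 𝒱.O₂ n p ≤ (𝒱.O₂ n m).comap ((𝒱.starL n m p).flip v) from this hx
  refine Submodule.span_le.2 ?_
  rintro _ ⟨a, b, c, u, p₁, p₂, p₃, rfl⟩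
  have h₁ := 𝒱.associator_mem_O₂ (n := n) (m := m) p p₃ u (𝒱.associator p p₁ p₂ p₃ a b c) v
  have h₂ := 𝒱.star_mem_O₂ (n := n) u
    (𝒱.star_associator_left_mem_O₂ (n := p₃) (m := m) p p₁ p₂ a b c v)
  have h := add_mem h₁ h₂
  rwa [associator, sub_add_cancel] at h

theorem star_left_mem_O (u : V) {x : V} (hx : x ∈ 𝒱.O n m) : 𝒱.star n m n u x ∈ 𝒱.O n m := by
  suffices 𝒱.O n m ≤ (𝒱.O n m).comap (𝒱.starL n m n u) from this hx
  refine sup_le (sup_le (fun x hx ↦ 𝒱.O₁_le_O (𝒱.star_left_mem_O₁ u hx))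
    fun x hx ↦ 𝒱.O₂_le_O (𝒱.star_mem_O₂ u hx)) (Submodule.span_le.2 ?_)
  rintro _ ⟨p, w, v, y, hy, rfl⟩
  -- Modulo associators, u((wy)v) becomes ((uw)y)v, again a generator of O'''.
  have h₁ := 𝒱.O₂_le_O (𝒱.associator_mem_O₂ (n := n) (m := m) p n u (𝒱.rightStar n p w y) v)
  have h₂ := 𝒱.O₂_le_O (𝒱.star_associator_left_mem_O₂ (n := n) (m := m) p p n u w y v)
  have h₃ : 𝒱.star n m p (𝒱.rightStar n p (𝒱.star n p n u w) y) v ∈ 𝒱.O n m :=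
    𝒱.O₃_le_O (Submodule.subset_span ⟨p, _, v, y, hy, rfl⟩)
  change 𝒱.star n m n u (𝒱.star n m p (𝒱.rightStar n p w y) v) ∈ 𝒱.O n m
  convert sub_mem h₃ (add_mem h₁ h₂) using 1
  simp only [associator, rightStar, ← starL_apply, map_sub, LinearMap.sub_apply]
  abel

theorem star_right_mem_O {x : V} (hx : x ∈ 𝒱.O n m) (v : V) : 𝒱.star n m m x v ∈ 𝒱.O n m := by
  suffices 𝒱.O n m ≤ (𝒱.O n m).comap ((𝒱.starL n m m).flip v) from this hx
  refine sup_le (sup_le (fun x hx ↦ 𝒱.O₁_le_O (𝒱.star_right_mem_O₁ hx v))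
    fun x hx ↦ 𝒱.O₂_le_O (𝒱.star_right_mem_O₂ hx v)) (Submodule.span_le.2 ?_)
  rintro _ ⟨p, u, w, y, hy, rfl⟩
  have h₁ := 𝒱.O₂_le_O (𝒱.associator_mem_O₂ (n := n) (m := m) m p (𝒱.rightStar n p u y) w v)
  have h₂ : 𝒱.star n m p (𝒱.rightStar n p u y) (𝒱.star p m m w v) ∈ 𝒱.O n m :=
    𝒱.O₃_le_O (Submodule.subset_span ⟨p, u, _, y, hy, rfl⟩)
  have h := add_mem h₁ h₂
  rwa [associator, sub_add_cancel] at h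

theorem star_mem_O_of_left_mem {y : V} (hy : y ∈ 𝒱.O₁ n n) (v : V) :
    𝒱.star n m n y v ∈ 𝒱.O n m := by
  refine 𝒱.O₃_le_O (Submodule.subset_span ⟨n, 𝒱.vac, v, y, hy, ?_⟩)
  rw [rightStar, star_vac_left]

/-- The product (uy)𝟏 is in O''' and agrees with uy modulo O'. This makes the right action descend
to A_m. -/
theorem star_mem_O_of_right_mem (u : V) {y : V} (hy : y ∈ 𝒱.O₁ m m) :
    𝒱.star n m m u y ∈ 𝒱.O n m := by
  have h₁ : 𝒱.star n m m (𝒱.rightStar n m u y) 𝒱.vac ∈ 𝒱.O n m :=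
    𝒱.O₃_le_O (Submodule.subset_span ⟨m, u, 𝒱.vac, y, hy, rfl⟩)
  have h := sub_mem h₁ (𝒱.O₁_le_O (𝒱.star_vac_right_sub_mem_O₁ (𝒱.rightStar n m u y)))
  rwa [sub_sub_cancel] at h

end Bimodule

end VertexOperatorAlgebra

/-! ### Passage to the quotients. -/

section Quotient

variable {R U V W : Type*} [CommRing R] [AddCommGroup U] [Module R U] [AddCommGroup V] [Module R V]
  [AddCommGroup W] [Module R W]

/-- The bilinear map on quotients induced by a bilinear map. -/
def Submodule.mapQ₂ (S : Submodule R U) (T : Submodule R V) (Q : Submodule R W)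
    (f : U →ₗ[R] V →ₗ[R] W) (hl : ∀ u ∈ S, ∀ v, f u v ∈ Q) (hr : ∀ u, ∀ v ∈ T, f u v ∈ Q) :
    U ⧸ S →ₗ[R] V ⧸ T →ₗ[R] W ⧸ Q :=
  S.liftQ
    { toFun := fun u ↦ T.mapQ Q (f u) (hr u)
      map_add' := fun u u' ↦ by
        ext v
        simp
      map_smul' := fun c u ↦ by
        ext v
        simp }
    fun u hu ↦ by
      rw [LinearMap.mem_ker]
      ext v
      exact (Submodule.Quotient.mk_eq_zero Q).2 (hl u hu v)

end Quotient

namespace VertexOperatorAlgebra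

variable {V : Type*} [AddCommGroup V] [Module ℂ V] (𝒱 : VertexOperatorAlgebra V)

section Algebra

variable (n : ℕ)

noncomputable instance : AddCommGroup (𝒱.Aalg n) := inferInstanceAs (AddCommGroup (V ⧸ 𝒱.O₁ n n))

noncomputable instance : Module ℂ (𝒱.Aalg n) := inferInstanceAs (Module ℂ (V ⧸ 𝒱.O₁ n n))

/-- The product of `A_n(V)` as a bilinear map. -/
noncomputable def mulAalg : 𝒱.Aalg n →ₗ[ℂ] 𝒱.Aalg n →ₗ[ℂ] 𝒱.Aalg n :=
  Submodule.mapQ₂ (𝒱.O₁ n n) (𝒱.O₁ n n) (𝒱.O₁ n n) (𝒱.starL n n n)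
    (fun _ hu v ↦ 𝒱.star_right_mem_O₁ hu v) (fun u _ hv ↦ 𝒱.star_left_mem_O₁ u hv)

theorem mkAlg_surjective : Function.Surjective (𝒱.mkAlg n) :=
  Submodule.Quotient.mk_surjective (𝒱.O₁ n n)

theorem mkAlg_eq {u v : V} (h : u - v ∈ 𝒱.O₁ n n) : 𝒱.mkAlg n u = 𝒱.mkAlg n v :=
  (Submodule.Quotient.eq (𝒱.O₁ n n)).2 h

noncomputable instance : Ring (𝒱.Aalg n) :=
  { (inferInstance : AddCommGroup (𝒱.Aalg n)) with
    mul := fun x y ↦ 𝒱.mulAalg n x y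
    one := 𝒱.mkAlg n 𝒱.vac
    left_distrib := fun x y z ↦ map_add (𝒱.mulAalg n x) y z
    right_distrib := fun x y z ↦ LinearMap.map_add₂ (𝒱.mulAalg n) x y z
    zero_mul := fun x ↦ LinearMap.map_zero₂ (𝒱.mulAalg n) x
    mul_zero := fun x ↦ map_zero (𝒱.mulAalg n x)
    mul_assoc := fun x y z ↦ by
      obtain ⟨a, rfl⟩ := 𝒱.mkAlg_surjective n x
      obtain ⟨b, rfl⟩ := 𝒱.mkAlg_surjective n y
      obtain ⟨c, rfl⟩ := 𝒱.mkAlg_surjective n z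
      exact 𝒱.mkAlg_eq n (𝒱.star_assoc_sub_mem_O₁ a b c)
    one_mul := fun x ↦ by
      obtain ⟨a, rfl⟩ := 𝒱.mkAlg_surjective n x
      exact congrArg (𝒱.mkAlg n) (𝒱.star_vac_left a)
    mul_one := fun x ↦ by
      obtain ⟨a, rfl⟩ := 𝒱.mkAlg_surjective n x
      exact 𝒱.mkAlg_eq n (𝒱.star_vac_right_sub_mem_O₁ a) }

noncomputable instance : Algebra ℂ (𝒱.Aalg n) :=
  Algebra.ofModule (fun c x y ↦ LinearMap.map_smul₂ (𝒱.mulAalg n) c x y)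
    fun c x y ↦ map_smul (𝒱.mulAalg n x) c y

end Algebra

section Bimodule

variable (n m : ℕ)

/-- The left action of `A_n(V)` on `A_{n,m}(V)` as a bilinear map. -/
noncomputable def leftAct : 𝒱.Aalg n →ₗ[ℂ] 𝒱.Abi n m →ₗ[ℂ] 𝒱.Abi n m :=
  Submodule.mapQ₂ (𝒱.O₁ n n) (𝒱.O n m) (𝒱.O n m) (𝒱.starL n m n)
    (fun _ hu v ↦ 𝒱.star_mem_O_of_left_mem hu v) (fun u _ hv ↦ 𝒱.star_left_mem_O u hv)

/-- The right action of `A_m(V)` on `A_{n,m}(V)` as a bilinear map. -/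
noncomputable def rightAct : 𝒱.Aalg m →ₗ[ℂ] 𝒱.Abi n m →ₗ[ℂ] 𝒱.Abi n m :=
  Submodule.mapQ₂ (𝒱.O₁ m m) (𝒱.O n m) (𝒱.O n m) (𝒱.starL n m m).flip
    (fun _ hv u ↦ 𝒱.star_mem_O_of_right_mem u hv) (fun v _ hu ↦ 𝒱.star_right_mem_O hu v)

theorem mkBi_surjective : Function.Surjective (𝒱.mkBi n m) :=
  Submodule.Quotient.mk_surjective (𝒱.O n m)

theorem mkBi_eq {u v : V} (h : u - v ∈ 𝒱.O n m) : 𝒱.mkBi n m u = 𝒱.mkBi n m v :=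
  (Submodule.Quotient.eq (𝒱.O n m)).2 h

noncomputable instance : Module (𝒱.Aalg n) (𝒱.Abi n m) where
  smul x y := 𝒱.leftAct n m x y
  one_smul y := by
    obtain ⟨v, rfl⟩ := 𝒱.mkBi_surjective n m y
    exact congrArg (𝒱.mkBi n m) (𝒱.star_vac_left v)
  mul_smul x x' y := by
    obtain ⟨a, rfl⟩ := 𝒱.mkAlg_surjective n x
    obtain ⟨b, rfl⟩ := 𝒱.mkAlg_surjective n x'
    obtain ⟨v, rfl⟩ := 𝒱.mkBi_surjective n m y
    exact 𝒱.mkBi_eq n m (𝒱.O₂_le_O (𝒱.associator_mem_O₂ n n a b v))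
  smul_zero x := map_zero (𝒱.leftAct n m x)
  smul_add x := map_add (𝒱.leftAct n m x)
  add_smul x x' y := LinearMap.map_add₂ (𝒱.leftAct n m) x x' y
  zero_smul y := LinearMap.map_zero₂ (𝒱.leftAct n m) y

noncomputable instance : Module (𝒱.Aalg m)ᵐᵒᵖ (𝒱.Abi n m) where
  smul x y := 𝒱.rightAct n m x.unop y
  one_smul y := by
    obtain ⟨v, rfl⟩ := 𝒱.mkBi_surjective n m y
    exact 𝒱.mkBi_eq n m (𝒱.O₁_le_O (𝒱.star_vac_right_sub_mem_O₁ v))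
  mul_smul x x' y := by
    obtain ⟨a, ha⟩ := 𝒱.mkAlg_surjective m x.unop
    obtain ⟨b, hb⟩ := 𝒱.mkAlg_surjective m x'.unop
    obtain ⟨v, rfl⟩ := 𝒱.mkBi_surjective n m y
    obtain rfl : MulOpposite.op (𝒱.mkAlg m a) = x := by rw [ha, MulOpposite.op_unop]
    obtain rfl : MulOpposite.op (𝒱.mkAlg m b) = x' := by rw [hb, MulOpposite.op_unop]
    -- The opposite ring reverses the product: (va-action after b) is (vb)a, compared with v(ba).
    exact (𝒱.mkBi_eq n m (𝒱.O₂_le_O (𝒱.associator_mem_O₂ m m v b a))).symm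
  smul_zero x := map_zero (𝒱.rightAct n m x.unop)
  smul_add x := map_add (𝒱.rightAct n m x.unop)
  add_smul x x' y := LinearMap.map_add₂ (𝒱.rightAct n m) x.unop x'.unop y
  zero_smul y := LinearMap.map_zero₂ (𝒱.rightAct n m) y

instance : SMulCommClass (𝒱.Aalg n) (𝒱.Aalg m)ᵐᵒᵖ (𝒱.Abi n m) where
  smul_comm x x' y := by
    obtain ⟨a, rfl⟩ := 𝒱.mkAlg_surjective n x
    obtain ⟨b, hb⟩ := 𝒱.mkAlg_surjective m x'.unop
    obtain ⟨v, rfl⟩ := 𝒱.mkBi_surjective n m y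
    obtain rfl : MulOpposite.op (𝒱.mkAlg m b) = x' := by rw [hb, MulOpposite.op_unop]
    exact (𝒱.mkBi_eq n m (𝒱.O₂_le_O (𝒱.associator_mem_O₂ m n a v b))).symm

instance : IsScalarTower ℂ (𝒱.Aalg n) (𝒱.Abi n m) where
  smul_assoc c x y := LinearMap.map_smul₂ (𝒱.leftAct n m) c x y

instance : IsScalarTower ℂ (𝒱.Aalg m)ᵐᵒᵖ (𝒱.Abi n m) where
  smul_assoc c x y := LinearMap.map_smul₂ (𝒱.rightAct n m) c x.unop y

end Bimodule

end VertexOperatorAlgebra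

/-- Each `A_k(V)` is an associative unital `ℂ`-algebra (with the vector space structure of the
quotient) under `*_k`, and `A_{n,m}(V)` is an `A_n(V)`-`A_m(V)`-bimodule with left action induced
by `*̄_m^n` and right action induced by `*_m^n`. A right module over a ring is, as usual in Mathlib,
a module over the opposite ring. -/
theorem mainTheorem3 {V : Type*} [AddCommGroup V] [Module ℂ V] (𝒱 : VertexOperatorAlgebra V)
    (m n : ℕ) :
    ∃ (_ : ∀ k, Ring (𝒱.Aalg k)) (_ : ∀ k, Algebra ℂ (𝒱.Aalg k)),
      (∀ k, IsLinearMap ℂ (𝒱.mkAlg k)) ∧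
      (∀ k, 𝒱.mkAlg k 𝒱.vac = 1) ∧
      (∀ k u v, 𝒱.mkAlg k u * 𝒱.mkAlg k v = 𝒱.mkAlg k (𝒱.algStar k u v)) ∧
      ∃ (_ : Module (𝒱.Aalg n) (𝒱.Abi n m)) (_ : Module (𝒱.Aalg m)ᵐᵒᵖ (𝒱.Abi n m)),
        (∀ u v, 𝒱.mkAlg n u • 𝒱.mkBi n m v = 𝒱.mkBi n m (𝒱.leftStar n m u v)) ∧
        (∀ u v, MulOpposite.op (𝒱.mkAlg m v) • 𝒱.mkBi n m u =
          𝒱.mkBi n m (𝒱.rightStar n m u v)) ∧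
        SMulCommClass (𝒱.Aalg n) (𝒱.Aalg m)ᵐᵒᵖ (𝒱.Abi n m) ∧
        IsScalarTower ℂ (𝒱.Aalg n) (𝒱.Abi n m) ∧
        IsScalarTower ℂ (𝒱.Aalg m)ᵐᵒᵖ (𝒱.Abi n m) := by
  refine ⟨fun k ↦ inferInstance, fun k ↦ inferInstance, fun k ↦ ⟨fun _ _ ↦ rfl, fun _ _ ↦ rfl⟩,
    fun _ ↦ rfl, fun _ _ _ ↦ rfl, inferInstance, inferInstance, fun _ _ ↦ rfl, fun _ _ ↦ rfl,
    inferInstance, inferInstance, inferInstance⟩
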